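/- **Theorem (second gradient and two-scale convergence).** Let $\omega\subset\mathbb R^d$ be a bounded domain (open and connected, no regularity of the boundary assumed), let $Y:=[0,1)^d$, let $\varepsilon=\varepsilon_n>0$ be a sequence tending to $0$, and let $v_\varepsilon$ be a bounded sequence in $H^2(\omega)$ (real-valued). Then there exist a subsequence (not relabelled), a function $v\in H^2(\omega)$ and a function $\varphi\in L^2(\omega;H^2_{\rm per}(Y))$ with $\int_Y\varphi(x,y)\,dy=0$ for a.e. $x\in\omega$ such that along this subsequence: (1) $v_\varepsilon\rightharpoonup v$ weakly in $H^2(\omega)$; moreover $v_\varepsilon\to v$ strongly in $H^1(K)$, i.e. $v_\varepsilon\to v$ and $\nabla v_\varepsilon\to\nabla v$ in $L^2(K)$, for every compact $K\subset\omega$, and $v_\varepsilon\to v$ strongly in $H^1(\omega)$ if $\omega$ has the segment property (for instance, if $\omega$ is convex or Lipschitz); (2) $\nabla^2v_\varepsilon$ converges weakly two-scale to $\nabla^2v(x)+\nabla_y^2\varphi(x,y)$, that is, $\nabla^2 v_\varepsilon$ is bounded in $L^2(\omega)$ and $$\mathcal T_\varepsilon(\nabla^2v_\varepsilon)\rightharpoonup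 \nabla^2v(x)+\nabla_y^2\varphi(x,y)\quad\text{weakly in } L^2(\omega\times Y).$$ Here $\mathcal T_\varepsilon$ is the unfolding operator: $\mathcal T_\varepsilon(f)(x,y):=f\big(\varepsilon[x/\varepsilon]+\varepsilon y\big)$ if the cell $\varepsilon([x/\varepsilon]+Y)$ is contained in $\omega$, and $\mathcal T_\varepsilon(f)(x,y):=0$ otherwise, where $[\cdot]$ is the componentwise integer part. $H^2_{\rm per}(Y)$ is the $H^2$ space of the torus $\mathbb R^d/\mathbb Z^d$: functions in $L^2(Y)$ having weak derivatives of first and second order in $L^2(Y)$ with respect to $\mathbb Z^d$-periodic test functions in $C^\infty(\mathbb R^d)$. The segment property means: every $x_0\in\partial\omega$ has a neighbourhood $U$ and a vector $\xi$ such that $x+t\xi\in\omega$ for all $x\in\overline\omega\cap U$ and $0<t<1$. -/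

import Mathlib

open MeasureTheory Filter Topology

noncomputable section

namespace TwoScale

/-- `ℝ^d` with its Euclidean structure. -/
abbrev Space (d : ℕ) : Type := EuclideanSpace ℝ (Fin d)

/-- The half-open unit cell `Y = [0,1)^d`. -/
def unitCell (d : ℕ) : Set (Space d) := {y | ∀ i, y i ∈ Set.Ico (0 : ℝ) 1}

/-- The classical partial derivative `∂φ/∂x_i`. -/
def partialDeriv {d : ℕ} (i : Fin d) (φ : Space d → ℝ) (x : Space d) : ℝ :=
  fderiv ℝ φ x (EuclideanSpace.single i 1)

/-- The test functions `C_c^∞(ω)`. -/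
def testFunctions {d : ℕ} (ω : Set (Space d)) : Set (Space d → ℝ) :=
  {φ | ContDiff ℝ (⊤ : ℕ∞) φ ∧ HasCompactSupport φ ∧ tsupport φ ⊆ ω}

/-- The `ℤ^d`-periodic functions in `C^∞(ℝ^d)`. -/
def periodicTestFunctions (d : ℕ) : Set (Space d → ℝ) :=
  {φ | ContDiff ℝ (⊤ : ℕ∞) φ ∧ ∀ (i : Fin d) (x : Space d), φ (x + EuclideanSpace.single i 1) = φ x}

lemma continuous_partialDeriv {d : ℕ} {φ : Space d → ℝ} (h : ContDiff ℝ (⊤ : ℕ∞) φ) (i : Fin d) :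
    Continuous (partialDeriv i φ) :=
  (h.continuous_fderiv (by simp)).clm_apply continuous_const

lemma testFunctions_memLp {d : ℕ} (ω : Set (Space d)) :
    ∀ φ ∈ testFunctions ω, MemLp φ 2 (volume.restrict ω) ∧
      ∀ i, MemLp (partialDeriv i φ) 2 (volume.restrict ω) := by
  rintro φ ⟨h1, h2, -⟩
  refine ⟨(h1.continuous.memLp_of_hasCompactSupport h2).restrict ω, fun i => ?_⟩
  refine ((continuous_partialDeriv h1 i).memLp_of_hasCompactSupport ?_).restrict ω
  exact (h2.fderiv ℝ).comp_left (g := fun L : Space d →L[ℝ] ℝ => L (EuclideanSpace.single i 1))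
    (by simp)

lemma unitCell_subset (d : ℕ) :
    unitCell d ⊆ (EuclideanSpace.equiv (Fin d) ℝ).toHomeomorph ⁻¹' (Set.Icc 0 1) := by
  intro y hy
  exact ⟨fun i => (hy i).1, fun i => (hy i).2.le⟩

lemma memLp_unitCell {d : ℕ} {f : Space d → ℝ} (hf : Continuous f) :
    MemLp f 2 (volume.restrict (unitCell d)) := by
  have hK : IsCompact ((EuclideanSpace.equiv (Fin d) ℝ).toHomeomorph ⁻¹' (Set.Icc 0 1)) :=
    (EuclideanSpace.equiv (Fin d) ℝ).toHomeomorph.isCompact_preimage.2 isCompact_Icc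
  refine MemLp.mono_measure (Measure.restrict_mono (unitCell_subset d) le_rfl) ?_
  obtain ⟨C, hC⟩ := hK.exists_bound_of_continuousOn hf.continuousOn
  have : IsFiniteMeasure (volume.restrict
      ((EuclideanSpace.equiv (Fin d) ℝ).toHomeomorph ⁻¹' (Set.Icc 0 1))) :=
    ⟨by simpa using hK.measure_lt_top⟩
  refine MemLp.of_bound hf.aestronglyMeasurable C ?_
  exact (ae_restrict_iff' hK.measurableSet).2 (Eventually.of_forall fun x hx => hC x hx)

lemma periodicTestFunctions_memLp (d : ℕ) :
    ∀ φ ∈ periodicTestFunctions d, MemLp φ 2 (volume.restrict (unitCell d)) ∧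
      ∀ i, MemLp (partialDeriv i φ) 2 (volume.restrict (unitCell d)) := by
  rintro φ ⟨h1, -⟩
  exact ⟨memLp_unitCell h1.continuous, fun i => memLp_unitCell (continuous_partialDeriv h1 i)⟩

/-- `g` is the weak partial derivative `∂u/∂x_i` with respect to the test class `T`:
`∫ u ∂_i φ dμ = - ∫ g φ dμ` for all `φ ∈ T`. -/
def HasWeakPartial {d : ℕ} (μ : Measure (Space d)) (T : Set (Space d → ℝ)) (i : Fin d)
    (u g : Lp ℝ 2 μ) : Prop :=
  ∀ φ ∈ T, ∫ x, u x * partialDeriv i φ x ∂μ = -∫ x, g x * φ x ∂μ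

lemma integral_add_mul {α : Type*} [MeasurableSpace α] {μ : Measure α} (u v : Lp ℝ 2 μ)
    {c : α → ℝ} (hc : MemLp c 2 μ) :
    ∫ x, (u + v) x * c x ∂μ = ∫ x, u x * c x ∂μ + ∫ x, v x * c x ∂μ := by
  have hu : Integrable (fun x => u x * c x) μ := (Lp.memLp u).integrable_mul hc
  have hv : Integrable (fun x => v x * c x) μ := (Lp.memLp v).integrable_mul hc
  rw [← integral_add hu hv]
  refine integral_congr_ae ?_
  filter_upwards [Lp.coeFn_add u v] with x hx
  rw [hx, Pi.add_apply, add_mul]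

lemma integral_smul_mul {α : Type*} [MeasurableSpace α] {μ : Measure α} (a : ℝ) (u : Lp ℝ 2 μ)
    (c : α → ℝ) :
    ∫ x, (a • u) x * c x ∂μ = a * ∫ x, u x * c x ∂μ := by
  rw [← integral_const_mul]
  refine integral_congr_ae ?_
  filter_upwards [Lp.coeFn_smul a u] with x hx
  rw [hx, Pi.smul_apply, smul_eq_mul, mul_assoc]

lemma integral_zero_mul {α : Type*} [MeasurableSpace α] {μ : Measure α} (c : α → ℝ) :
    ∫ x, (0 : Lp ℝ 2 μ) x * c x ∂μ = 0 := by
  have := integral_smul_mul (0 : ℝ) (0 : Lp ℝ 2 μ) c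
  simpa using this

/-- Indices for the entries of a second order jet `(u, ∇u, ∇²u)`. -/
abbrev JetIndex (d : ℕ) : Type := Unit ⊕ Fin d ⊕ (Fin d × Fin d)

/-- Second order jets of square integrable functions, with the norm
`(‖u‖² + ∑ ‖u_i‖² + ∑ ‖u_ij‖²)^{1/2}` built from the `L²(μ)` norms of the entries. -/
abbrev Jet {d : ℕ} (μ : Measure (Space d)) : Type :=
  PiLp 2 (fun _ : JetIndex d => Lp ℝ 2 μ)

/-- The entry `u` of a jet. -/
def Jet.val {d : ℕ} {μ : Measure (Space d)} (J : Jet μ) : Lp ℝ 2 μ := J (Sum.inl ())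

/-- The entry `∂_i u` of a jet. -/
def Jet.grad {d : ℕ} {μ : Measure (Space d)} (J : Jet μ) (i : Fin d) : Lp ℝ 2 μ :=
  J (Sum.inr (Sum.inl i))

/-- The entry `∂_j ∂_i u` of a jet. -/
def Jet.hess {d : ℕ} {μ : Measure (Space d)} (J : Jet μ) (i j : Fin d) : Lp ℝ 2 μ :=
  J (Sum.inr (Sum.inr (i, j)))

/-- The second order Sobolev space for the measure `μ` and the test class `T`: a function `u` in
`L²(μ)` with weak first and second derivatives in `L²(μ)`, recorded together with these
derivatives (which `u` determines in both uses below), and normed by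
`‖u‖² = ∑_{|α| ≤ 2} ‖∂^α u‖²_{L²(μ)}` (ordered pairs in the second order term). -/
def weakH2 {d : ℕ} (μ : Measure (Space d)) (T : Set (Space d → ℝ))
    (hT : ∀ φ ∈ T, MemLp φ 2 μ ∧ ∀ i, MemLp (partialDeriv i φ) 2 μ) : Submodule ℝ (Jet μ) where
  carrier := {J | (∀ i, HasWeakPartial μ T i J.val (J.grad i)) ∧
    ∀ i j, HasWeakPartial μ T j (J.grad i) (J.hess i j)}
  add_mem' := by
    have key : ∀ (i : Fin d) (u g u' g' : Lp ℝ 2 μ), HasWeakPartial μ T i u g →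
        HasWeakPartial μ T i u' g' → HasWeakPartial μ T i (u + u') (g + g') := by
      intro i u g u' g' h h' φ hφ
      rw [integral_add_mul u u' ((hT φ hφ).2 i), integral_add_mul g g' (hT φ hφ).1, h φ hφ,
        h' φ hφ]
      ring
    rintro J J' ⟨h1, h2⟩ ⟨h1', h2'⟩
    exact ⟨fun i => key i _ _ _ _ (h1 i) (h1' i), fun i j => key j _ _ _ _ (h2 i j) (h2' i j)⟩
  zero_mem' := by
    have key : ∀ i : Fin d, HasWeakPartial μ T i 0 0 := by
      intro i φ _
      rw [integral_zero_mul, integral_zero_mul, neg_zero]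
    exact ⟨fun i => key i, fun i j => key j⟩
  smul_mem' := by
    have key : ∀ (i : Fin d) (a : ℝ) (u g : Lp ℝ 2 μ), HasWeakPartial μ T i u g →
        HasWeakPartial μ T i (a • u) (a • g) := by
      intro i a u g h φ hφ
      rw [integral_smul_mul, integral_smul_mul, h φ hφ]
      ring
    rintro a J ⟨h1, h2⟩
    exact ⟨fun i => key i a _ _ (h1 i), fun i j => key j a _ _ (h2 i j)⟩

/-- The Sobolev space `H²(ω)`. -/
def H2 {d : ℕ} (ω : Set (Space d)) : Submodule ℝ (Jet (volume.restrict ω)) :=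
  weakH2 (volume.restrict ω) (testFunctions ω) (testFunctions_memLp ω)

/-- The space `H²_per(Y)` of periodic functions on the cell with two weak derivatives in `L²`,
that is, `H²` of the torus `ℝ^d/ℤ^d`: the weak derivatives are taken against smooth periodic
functions, so that no jump of `u` or `∇u` across opposite faces of the cell is allowed. -/
def H2per (d : ℕ) : Submodule ℝ (Jet (volume.restrict (unitCell d))) :=
  weakH2 (volume.restrict (unitCell d)) (periodicTestFunctions d) (periodicTestFunctions_memLp d)

/-- The Bochner space `L²(ω; H²_per(Y))`. -/
abbrev L2H2per {d : ℕ} (ω : Set (Space d)) : Type := Lp (H2per d) 2 (volume.restrict ω)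

/-- The measure on `ω × Y`. -/
def cellMeasure {d : ℕ} (ω : Set (Space d)) : Measure (Space d × Space d) :=
  (volume.restrict ω).prod (volume.restrict (unitCell d))

/-- The jointly measurable function `F` on `ω × Y` represents the second derivative
`∂_{y_j} ∂_{y_i} φ` of `φ ∈ L²(ω; H²_per(Y))`. -/
def RepresentsHess {d : ℕ} {ω : Set (Space d)} (φ : L2H2per ω) (i j : Fin d)
    (F : Space d × Space d → ℝ) : Prop :=
  AEStronglyMeasurable F (cellMeasure ω) ∧
    ∀ᵐ x ∂(volume.restrict ω),
      (fun y => F (x, y)) =ᵐ[volume.restrict (unitCell d)] (φ x).1.hess i j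

/-- The corner `ε [x/ε]` of the cell of the lattice `ε ℤ^d` that contains `x`. -/
def cellCorner {d : ℕ} (ε : ℝ) (x : Space d) : Space d :=
  WithLp.toLp 2 (fun i => ε * (⌊x i / ε⌋ : ℝ))

open Classical in
/-- The unfolding operator `T_ε`: `T_ε(v)(x,y) = v(ε [x/ε] + ε y)` if the cell `ε ([x/ε] + Y)`
lies in `ω`, and `0` otherwise. -/
def unfolding {d : ℕ} (ω : Set (Space d)) (ε : ℝ) (v : Space d → ℝ) (p : Space d × Space d) : ℝ :=
  if (∀ y ∈ unitCell d, cellCorner ε p.1 + ε • y ∈ ω) then v (cellCorner ε p.1 + ε • p.2) else 0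

/-- Weak convergence in a normed space. -/
def ConvergesWeakly {X : Type*} [NormedAddCommGroup X] [NormedSpace ℝ X] (x : ℕ → X) (a : X) :
    Prop :=
  ∀ f : X →L[ℝ] ℝ, Tendsto (fun n => f (x n)) atTop (𝓝 (f a))

/-- Weak convergence of functions in `L²(μ)`. -/
def ConvergesWeaklyL2 {α : Type*} [MeasurableSpace α] (μ : Measure α) (f : ℕ → α → ℝ)
    (g : α → ℝ) : Prop :=
  (∀ n, MemLp (f n) 2 μ) ∧ MemLp g 2 μ ∧
    ∀ ψ : α → ℝ, MemLp ψ 2 μ →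
      Tendsto (fun n => ∫ p, f n p * ψ p ∂μ) atTop (𝓝 (∫ p, g p * ψ p ∂μ))

/-- Weak two-scale convergence: the sequence `f n` is bounded in `L²(ω)` and the unfoldings
`T_{ε n}(f n)` converge weakly in `L²(ω × Y)` to `g`. -/
def ConvergesWeaklyTwoScale {d : ℕ} (ω : Set (Space d)) (ε : ℕ → ℝ)
    (f : ℕ → Lp ℝ 2 (volume.restrict ω)) (g : Space d × Space d → ℝ) : Prop :=
  (∃ C : ℝ, ∀ n, ‖f n‖ ≤ C) ∧
    ConvergesWeaklyL2 (cellMeasure ω) (fun n => unfolding ω (ε n) (f n)) g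

/-- Strong convergence in `H¹(A)`, for `A ⊆ ω`, of a sequence in `H²(ω)`. -/
def ConvergesStronglyH1 {d : ℕ} {ω : Set (Space d)} (A : Set (Space d)) (u : ℕ → H2 ω)
    (v : H2 ω) : Prop :=
  Tendsto (fun n => eLpNorm (fun x => (u n).1.val x - v.1.val x) 2
      (volume.restrict A)) atTop (𝓝 0) ∧
    ∀ i, Tendsto (fun n => eLpNorm (fun x => (u n).1.grad i x - v.1.grad i x) 2
      (volume.restrict A)) atTop (𝓝 0)

/-- The segment property of a domain; bounded Lipschitz domains and bounded convex domains
have it. -/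
def HasSegmentProperty {d : ℕ} (ω : Set (Space d)) : Prop :=
  ∀ x₀ ∈ frontier ω, ∃ r > 0, ∃ ξ : Space d, ∀ x ∈ closure ω ∩ Metric.ball x₀ r,
    ∀ t ∈ Set.Ioo (0 : ℝ) 1, x + t • ξ ∈ ω

end TwoScale

end

open MeasureTheory Filter Topology

noncomputable section

namespace TwoScale

lemma exists_weakly_convergent_subseq_of_separable {H : Type*} [NormedAddCommGroup H]
    [InnerProductSpace ℝ H] [CompleteSpace H] [TopologicalSpace.SeparableSpace H] (x : ℕ → H)
    (C : ℝ) (hx : ∀ n, ‖x n‖ ≤ C) :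
    ∃ σ : ℕ → ℕ, StrictMono σ ∧ ∃ a : H, ∀ y, Tendsto (fun n => inner ℝ (x (σ n)) y) atTop
      (𝓝 (inner ℝ a y)) := by
  have hc := WeakDual.isSeqCompact_closedBall ℝ H 0 C
  let F : ℕ → WeakDual ℝ H := fun n => StrongDual.toWeakDual (InnerProductSpace.toDual ℝ H (x n))
  have hF : ∀ n, F n ∈ WeakDual.toStrongDual ⁻¹' Metric.closedBall (0 : StrongDual ℝ H) C := by
    intro n
    simp only [Set.mem_preimage, mem_closedBall_zero_iff]
    exact (LinearIsometryEquiv.norm_map (InnerProductSpace.toDual ℝ H) (x n)).le.trans (hx n)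
  obtain ⟨a, -, σ, hσ, h⟩ := hc hF
  refine ⟨σ, hσ, (InnerProductSpace.toDual ℝ H).symm (WeakDual.toStrongDual a), fun y => ?_⟩
  rw [InnerProductSpace.toDual_symm_apply]
  exact ((WeakDual.eval_continuous y).tendsto a).comp h

/-- Bounded sequences in a Hilbert space have weakly convergent subsequences. -/
lemma exists_weakly_convergent_subseq {H : Type*} [NormedAddCommGroup H]
    [InnerProductSpace ℝ H] [CompleteSpace H] (x : ℕ → H) (C : ℝ) (hx : ∀ n, ‖x n‖ ≤ C) :
    ∃ σ : ℕ → ℕ, StrictMono σ ∧ ∃ a : H, ∀ y, Tendsto (fun n => inner ℝ (x (σ n)) y) atTop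
      (𝓝 (inner ℝ a y)) := by
  let V : Submodule ℝ H := (Submodule.span ℝ (Set.range x)).topologicalClosure
  have hV : IsClosed (V : Set H) := Submodule.isClosed_topologicalClosure _
  have : CompleteSpace V := hV.completeSpace_coe
  have hsep : TopologicalSpace.IsSeparable (V : Set H) := by
    rw [Submodule.topologicalClosure_coe]
    exact ((Set.countable_range x).isSeparable.span (R := ℝ)).closure
  have : TopologicalSpace.SeparableSpace V := hsep.separableSpace
  have hmem : ∀ n, x n ∈ V := fun n =>
    Submodule.le_topologicalClosure _ (Submodule.subset_span ⟨n, rfl⟩)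
  obtain ⟨σ, hσ, a, h⟩ := exists_weakly_convergent_subseq_of_separable
    (fun n => (⟨x n, hmem n⟩ : V)) C hx
  refine ⟨σ, hσ, a, fun y => ?_⟩
  have key : ∀ z : V, inner ℝ (z : H) y = inner ℝ z (V.orthogonalProjectionOnto y) := by
    intro z
    rw [Submodule.inner_orthogonalProjectionOnto_eq_of_mem_left]
  have := h (V.orthogonalProjectionOnto y)
  simp_rw [← key] at this
  exact this

lemma inner_toLp {α : Type*} [MeasurableSpace α] {μ : Measure α} (f : Lp ℝ 2 μ) {ψ : α → ℝ}
    (hψ : MemLp ψ 2 μ) : inner ℝ f hψ.toLp = ∫ x, f x * ψ x ∂μ := by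
  rw [L2.inner_def]
  refine integral_congr_ae ?_
  filter_upwards [hψ.coeFn_toLp] with x hx
  rw [hx]
  simp [mul_comm]

lemma inner_eq_integral {α : Type*} [MeasurableSpace α] {μ : Measure α} (f g : Lp ℝ 2 μ) :
    inner ℝ f g = ∫ x, f x * g x ∂μ := by
  rw [L2.inner_def]
  simp [mul_comm]

lemma norm_sq_eq_integral {α : Type*} [MeasurableSpace α] {μ : Measure α} (f : Lp ℝ 2 μ) :
    ‖f‖ ^ 2 = ∫ x, f x ^ 2 ∂μ := by
  rw [← real_inner_self_eq_norm_sq, inner_eq_integral]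
  simp [sq]

/-- The weak partial derivative relation passes to limits of the pairings with test functions. -/
lemma HasWeakPartial.of_tendsto {d : ℕ} {μ : Measure (Space d)} {T : Set (Space d → ℝ)}
    (hT : ∀ φ ∈ T, MemLp φ 2 μ ∧ ∀ i, MemLp (partialDeriv i φ) 2 μ) {i : Fin d}
    {u g : ℕ → Lp ℝ 2 μ} {u₀ g₀ : Lp ℝ 2 μ}
    (h : ∀ n, HasWeakPartial μ T i (u n) (g n))
    (hu : ∀ y, Tendsto (fun n => inner ℝ (u n) y) atTop (𝓝 (inner ℝ u₀ y)))
    (hg : ∀ y, Tendsto (fun n => inner ℝ (g n) y) atTop (𝓝 (inner ℝ g₀ y))) :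
    HasWeakPartial μ T i u₀ g₀ := by
  intro φ hφ
  have h1 := hu ((hT φ hφ).2 i).toLp
  have h2 := (hg (hT φ hφ).1.toLp).neg
  simp_rw [inner_toLp] at h1 h2
  simp_rw [h _ φ hφ] at h1
  exact tendsto_nhds_unique h1 h2

lemma weakH2_mem_of_tendsto {d : ℕ} {μ : Measure (Space d)} {T : Set (Space d → ℝ)}
    (hT : ∀ φ ∈ T, MemLp φ 2 μ ∧ ∀ i, MemLp (partialDeriv i φ) 2 μ)
    {J : ℕ → Jet μ} {J₀ : Jet μ} (hJ : ∀ n, J n ∈ weakH2 μ T hT)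
    (h : ∀ (ι : JetIndex d) y, Tendsto (fun n => inner ℝ (J n ι) y) atTop
      (𝓝 (inner ℝ (J₀ ι) y))) : J₀ ∈ weakH2 μ T hT :=
  ⟨fun i => HasWeakPartial.of_tendsto hT (fun n => (hJ n).1 i) (h _) (h _),
    fun i j => HasWeakPartial.of_tendsto hT (fun n => (hJ n).2 i j) (h _) (h _)⟩

lemma isClosed_weakH2 {d : ℕ} {μ : Measure (Space d)} {T : Set (Space d → ℝ)}
    (hT : ∀ φ ∈ T, MemLp φ 2 μ ∧ ∀ i, MemLp (partialDeriv i φ) 2 μ) :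
    IsClosed (weakH2 μ T hT : Set (Jet μ)) := by
  refine IsSeqClosed.isClosed fun J J₀ hJ h => ?_
  refine weakH2_mem_of_tendsto hT hJ fun ι y => ?_
  have : Continuous fun K : Jet μ => inner ℝ (K ι) y := by fun_prop
  exact (this.tendsto J₀).comp h

/-- If the pairings of `f ∈ L²(A)` with test functions are controlled by the `L²` norm, then so
is the norm of `f`. -/
lemma norm_le_of_forall_testFunctions {d : ℕ} {A : Set (Space d)} (hA : IsOpen A)
    (f : Lp ℝ 2 (volume.restrict A)) (C : ℝ) (hC : 0 ≤ C)
    (h : ∀ φ (hφ : φ ∈ testFunctions A),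
      ∫ x in A, f x * φ x ≤ C * ‖((testFunctions_memLp A φ hφ).1).toLp‖) : ‖f‖ ≤ C := by
  let V : Submodule ℝ (Lp ℝ 2 (volume.restrict A)) :=
    { carrier := {g | ∃ φ ∈ testFunctions A, (g : Space d → ℝ) =ᵐ[volume.restrict A] φ}
      add_mem' := by
        rintro g g' ⟨φ, ⟨h1, h2, h3⟩, h⟩ ⟨φ', ⟨h1', h2', h3'⟩, h'⟩
        refine ⟨φ + φ', ⟨h1.add h1', h2.add h2', ?_⟩, ?_⟩
        · exact (tsupport_add φ φ').trans (Set.union_subset h3 h3')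
        · exact (Lp.coeFn_add g g').trans (h.add h')
      zero_mem' := by
        refine ⟨0, ⟨contDiff_const, HasCompactSupport.zero, ?_⟩, Lp.coeFn_zero _ _ _⟩
        simp [tsupport]
      smul_mem' := by
        rintro c g ⟨φ, ⟨h1, h2, h3⟩, h⟩
        refine ⟨c • φ, ⟨contDiff_const.smul h1, h2.smul_left (f := fun _ => c), ?_⟩, ?_⟩
        · exact (closure_mono (Function.support_const_smul_subset c φ)).trans h3
        · exact (Lp.coeFn_smul c g).trans (h.const_smul c) }
  have hV : V.topologicalClosure = ⊤ := by
    rw [Submodule.topologicalClosure_eq_top_iff, eq_bot_iff]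
    intro g hg
    rw [Submodule.mem_orthogonal'] at hg
    have hloc : LocallyIntegrableOn (g : Space d → ℝ) A (volume.restrict A) :=
      ((Lp.memLp g).locallyIntegrable (by norm_num)).locallyIntegrableOn A
    have := hA.ae_eq_zero_of_integral_contDiff_smul_eq_zero hloc (fun φ h1 h2 h3 => by
      have hφ : φ ∈ testFunctions A := ⟨h1, h2, h3⟩
      have := hg ((testFunctions_memLp A φ hφ).1).toLp ⟨φ, hφ, MemLp.coeFn_toLp _⟩
      rw [inner_toLp] at this
      simpa [mul_comm] using this)
    rw [Submodule.mem_bot]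
    refine (Lp.eq_zero_iff_ae_eq_zero).2 ?_
    filter_upwards [this, ae_restrict_mem hA.measurableSet] with x hx hxA using hx hxA
  have key : ∀ g : Lp ℝ 2 (volume.restrict A), inner ℝ f g ≤ C * ‖g‖ := by
    intro g
    have hg : g ∈ closure (V : Set _) := by
      rw [← Submodule.topologicalClosure_coe, hV]; trivial
    refine closure_minimal (s := (V : Set _)) (t := {g | inner ℝ f g ≤ C * ‖g‖}) ?_
      (isClosed_le (by fun_prop) (by fun_prop)) hg
    rintro g ⟨φ, hφ, hg⟩
    have hgφ : g = ((testFunctions_memLp A φ hφ).1).toLp := by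
      refine Lp.ext (hg.trans (MemLp.coeFn_toLp _).symm)
    rw [Set.mem_ofPred_eq, hgφ, inner_toLp]
    exact h φ hφ
  have := key f
  rw [real_inner_self_eq_norm_sq] at this
  by_contra! hlt
  nlinarith

/-- Pettis' theorem in a separable Hilbert space. -/
lemma aestronglyMeasurable_of_inner {α H : Type*} [MeasurableSpace α] {μ : Measure α}
    [NormedAddCommGroup H] [InnerProductSpace ℝ H] [CompleteSpace H]
    [TopologicalSpace.SeparableSpace H] {g : α → H}
    (hg : ∀ y, AEStronglyMeasurable (fun x => inner ℝ y (g x)) μ) : AEStronglyMeasurable g μ := by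
  let U : ℕ → Submodule ℝ H := fun n =>
    Submodule.span ℝ (TopologicalSpace.denseSeq H '' Set.Iic n)
  have hfin : ∀ n, FiniteDimensional ℝ (U n) := fun n =>
    FiniteDimensional.span_of_finite ℝ ((Set.finite_Iic n).image _)
  have hmono : Monotone U := fun m n h =>
    Submodule.span_mono (Set.image_mono (Set.Iic_subset_Iic.2 h))
  have htop : ⊤ ≤ (⨆ n, U n).topologicalClosure := by
    intro y _
    have hd := TopologicalSpace.denseRange_denseSeq H
    refine closure_mono ?_ (hd y)
    rintro _ ⟨n, rfl⟩
    exact (le_iSup U n) (Submodule.subset_span ⟨n, Set.mem_Iic.2 le_rfl, rfl⟩)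
  refine aestronglyMeasurable_of_tendsto_ae atTop (f := fun n x => (U n).starProjection (g x))
    (fun n => ?_) (Eventually.of_forall fun x =>
      Submodule.starProjection_tendsto_self U hmono (g x) htop)
  have : (fun x => (U n).starProjection (g x)) = fun x =>
      ∑ i, (inner ℝ ((stdOrthonormalBasis ℝ (U n) i : U n) : H) (g x)) •
        ((stdOrthonormalBasis ℝ (U n) i : U n) : H) := by
    ext x
    rw [Submodule.starProjection_apply,
      (stdOrthonormalBasis ℝ (U n)).orthogonalProjectionOnto_apply_eq_sum]
    simp
  rw [this]
  exact Finset.aestronglyMeasurable_fun_sum _ fun i _ => (hg _).smul_const _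

instance separableSpace_Lp_restrict {d : ℕ} (A : Set (Space d)) :
    TopologicalSpace.SeparableSpace (Lp ℝ 2 (volume.restrict A)) := by
  have : Fact ((2 : ENNReal) ≠ ⊤) := ⟨by simp⟩
  infer_instance

lemma integrable_mul_of_memLp {α : Type*} [MeasurableSpace α] {μ : Measure α} {f g : α → ℝ}
    (hf : MemLp f 2 μ) (hg : MemLp g 2 μ) : Integrable (fun x => f x * g x) μ :=
  hf.integrable_mul hg

lemma abs_integral_mul_le {α : Type*} [MeasurableSpace α] {μ : Measure α} (f : Lp ℝ 2 μ)
    {ψ : α → ℝ} (hψ : MemLp ψ 2 μ) :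
    |∫ x, f x * ψ x ∂μ| ≤ ‖f‖ * (eLpNorm ψ 2 μ).toReal := by
  rw [← inner_toLp f hψ, ← Lp.norm_toLp ψ hψ]
  exact abs_real_inner_le_norm _ _

lemma fderiv_apply_eq_sum {d : ℕ} (φ : Space d → ℝ) (x h : Space d) :
    fderiv ℝ φ x h = ∑ i, h i * partialDeriv i φ x := by
  have hh : h = ∑ i, h i • EuclideanSpace.single i (1 : ℝ) := by
    ext j
    simp [Finset.sum_apply, Pi.single_apply]
  conv_lhs => rw [hh]
  simp [partialDeriv, map_sum]

lemma fderiv_comp_sub_right' {d : ℕ} (φ : Space d → ℝ) (a x : Space d) :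
    fderiv ℝ (fun y => φ (y - a)) x = fderiv ℝ φ (x - a) := by
  simp only [sub_eq_add_neg]
  exact fderiv_comp_add_right (-a)

lemma translate_mem_testFunctions {d : ℕ} {A ω : Set (Space d)} {φ : Space d → ℝ}
    (hφ : φ ∈ testFunctions A) {a : Space d} (h : ∀ x ∈ A, x + a ∈ ω) :
    (fun x => φ (x - a)) ∈ testFunctions ω := by
  obtain ⟨h1, h2, h3⟩ := hφ
  have hs : tsupport (fun x => φ (x - a)) = (Homeomorph.subRight a) ⁻¹' tsupport φ :=
    tsupport_comp_eq_preimage φ (Homeomorph.subRight a)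
  refine ⟨h1.comp (contDiff_id.sub contDiff_const), h2.comp_homeomorph (Homeomorph.subRight a), ?_⟩
  rw [hs]
  intro x hx
  simpa using h _ (h3 hx)

lemma eLpNorm_translate {d : ℕ} {φ : Space d → ℝ} (hφ : Continuous φ) (a : Space d) :
    eLpNorm (fun x => φ (x - a)) 2 volume = eLpNorm φ 2 volume :=
  eLpNorm_comp_measurePreserving hφ.aestronglyMeasurable (measurePreserving_sub_right volume a)

lemma eLpNorm_restrict_of_mem_testFunctions {d : ℕ} {A : Set (Space d)} (hA : MeasurableSet A)
    {φ : Space d → ℝ} (hφ : φ ∈ testFunctions A) :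
    eLpNorm φ 2 (volume.restrict A) = eLpNorm φ 2 volume := by
  rw [← eLpNorm_indicator_eq_eLpNorm_restrict hA, Set.indicator_eq_self.2]
  exact (subset_tsupport φ).trans hφ.2.2

/-- Duality form of the translation estimate for functions with square integrable weak
derivatives. -/
lemma abs_integral_mul_translate_sub_le {d : ℕ} {ω A : Set (Space d)}
    [IsFiniteMeasure (volume.restrict ω)] (hA : MeasurableSet A)
    {w : Lp ℝ 2 (volume.restrict ω)} {g : Fin d → Lp ℝ 2 (volume.restrict ω)}
    (hw : ∀ i, HasWeakPartial (volume.restrict ω) (testFunctions ω) i w (g i)) {h : Space d}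
    (hA' : ∀ x ∈ A, ∀ s ∈ Set.Icc (0 : ℝ) 1, x + s • h ∈ ω) {φ : Space d → ℝ}
    (hφ : φ ∈ testFunctions A) :
    |∫ x in ω, w x * (φ (x - h) - φ x)| ≤
      ‖h‖ * (∑ i, ‖g i‖) * (eLpNorm φ 2 (volume.restrict A)).toReal := by
  obtain ⟨h1, h2, h3⟩ := id hφ
  have htest : ∀ s ∈ Set.Icc (0 : ℝ) 1, (fun x => φ (x - s • h)) ∈ testFunctions ω := fun s hs =>
    translate_mem_testFunctions hφ fun x hx => hA' x hx s hs
  have hdiff : Differentiable ℝ φ := h1.differentiable (by simp)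
  have hcf : Continuous (fderiv ℝ φ) := h1.continuous_fderiv (by simp)
  obtain ⟨B, hB⟩ := (h2.fderiv ℝ).exists_bound_of_continuous hcf
  obtain ⟨B', hB'⟩ := h2.exists_bound_of_continuous h1.continuous
  have hwi : Integrable w (volume.restrict ω) := (Lp.memLp w).integrable (by norm_num)
  set G : ℝ → ℝ := fun s => ∫ x in ω, w x * φ (x - s • h) with hG
  set G' : ℝ → ℝ := fun s => ∫ x in ω, w x * -(fderiv ℝ φ (x - s • h) h) with hG'
  have hder : ∀ s, HasDerivAt G (G' s) s := by
    intro s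
    refine (hasDerivAt_integral_of_dominated_loc_of_deriv_le (𝕜 := ℝ) (s := Set.univ)
      (F := fun s x => w x * φ (x - s • h))
      (F' := fun s x => w x * -(fderiv ℝ φ (x - s • h) h))
      (bound := fun x => ‖w x‖ * (B * ‖h‖)) Filter.univ_mem ?_ ?_ ?_ ?_ ?_ ?_).2
    · refine Eventually.of_forall fun s => ?_
      exact hwi.aestronglyMeasurable.mul
        (h1.continuous.comp (by fun_prop : Continuous fun x => x - s • h)).aestronglyMeasurable
    · refine hwi.mul_bdd (c := B') ?_ (Eventually.of_forall fun x => hB' _)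
      exact (h1.continuous.comp (by fun_prop : Continuous fun x => x - s • h)).aestronglyMeasurable
    · refine hwi.aestronglyMeasurable.mul (Continuous.aestronglyMeasurable ?_)
      exact ((hcf.comp (by fun_prop : Continuous fun x => x - s • h)).clm_apply
        continuous_const).neg
    · refine Eventually.of_forall fun x t _ => ?_
      rw [norm_mul, norm_neg]
      gcongr
      exact (ContinuousLinearMap.le_opNorm _ _).trans (by gcongr; exact hB _)
    · exact hwi.norm.mul_const _
    · refine Eventually.of_forall fun x t _ => ?_
      refine HasDerivAt.const_mul _ ?_
      have e1 : HasDerivAt (fun t : ℝ => x - t • h) (-h) t := by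
        simpa using ((hasDerivAt_id t).smul_const h).const_sub x
      have := (hdiff (x - t • h)).hasFDerivAt.comp_hasDerivAt t e1
      rw [map_neg] at this
      exact this
  have hbound : ∀ s ∈ Set.Icc (0 : ℝ) 1,
      ‖G' s‖ ≤ ‖h‖ * (∑ i, ‖g i‖) * (eLpNorm φ 2 (volume.restrict A)).toReal := by
    intro s hs
    have ht := htest s hs
    have hm := testFunctions_memLp ω _ ht
    have e : G' s = ∑ i, h i * ∫ x in ω, g i x * φ (x - s • h) := by
      have e1 : ∀ x, w x * -(fderiv ℝ φ (x - s • h) h) =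
          ∑ i, -(h i) * (w x * partialDeriv i (fun y => φ (y - s • h)) x) := by
        intro x
        rw [fderiv_apply_eq_sum, ← Finset.sum_neg_distrib, Finset.mul_sum]
        refine Finset.sum_congr rfl fun i _ => ?_
        rw [partialDeriv, partialDeriv, fderiv_comp_sub_right']
        ring
      rw [hG']
      simp_rw [e1]
      have e2 : ∀ i ∈ Finset.univ, Integrable (fun x => -(h i) * (w x *
          partialDeriv i (fun y => φ (y - s • h)) x)) (volume.restrict ω) := fun i _ =>
        ((Lp.memLp w).integrable_mul (hm.2 i)).const_mul _
      rw [integral_finsetSum _ e2]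
      refine Finset.sum_congr rfl fun i _ => ?_
      rw [integral_const_mul, hw i _ ht]
      ring
    rw [e]
    refine (norm_sum_le _ _).trans ?_
    rw [Finset.mul_sum, Finset.sum_mul]
    refine Finset.sum_le_sum fun i _ => ?_
    rw [norm_mul, mul_assoc]
    have hn : eLpNorm (fun x => φ (x - s • h)) 2 (volume.restrict ω) ≤
        eLpNorm φ 2 (volume.restrict A) := by
      rw [eLpNorm_restrict_of_mem_testFunctions hA hφ, ← eLpNorm_translate h1.continuous (s • h)]
      exact eLpNorm_mono_measure _ Measure.restrict_le_self
    refine mul_le_mul (PiLp.norm_apply_le h i) ?_ (norm_nonneg _) (norm_nonneg _)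
    refine (abs_integral_mul_le (g i) hm.1).trans ?_
    gcongr
    exact (testFunctions_memLp A φ hφ).1.eLpNorm_ne_top
  have := Convex.norm_image_sub_le_of_norm_hasDerivWithin_le
    (fun s _ => (hder s).hasDerivWithinAt) hbound (convex_Icc (0 : ℝ) 1)
    (Set.left_mem_Icc.2 zero_le_one) (Set.right_mem_Icc.2 zero_le_one)
  rw [hG] at this
  have hint : ∀ s : ℝ, Integrable (fun x => w x * φ (x - s • h)) (volume.restrict ω) := by
    intro s
    refine hwi.mul_bdd (c := B') ?_ (Eventually.of_forall fun x => hB' _)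
    exact (h1.continuous.comp (by fun_prop : Continuous fun x => x - s • h)).aestronglyMeasurable
  have h10 := integral_sub (hint 1) (hint 0)
  simp only [one_smul, zero_smul, sub_zero, ← mul_sub] at h10
  rw [h10]
  simpa using this

/-- The translation estimate for functions with square integrable weak derivatives. -/
lemma eLpNorm_translate_sub_le {d : ℕ} {ω A : Set (Space d)}
    [IsFiniteMeasure (volume.restrict ω)] (hω : MeasurableSet ω) (hA : IsOpen A)
    {w : Lp ℝ 2 (volume.restrict ω)} {g : Fin d → Lp ℝ 2 (volume.restrict ω)}
    (hw : ∀ i, HasWeakPartial (volume.restrict ω) (testFunctions ω) i w (g i)) {h : Space d}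
    (hA' : ∀ x ∈ A, ∀ s ∈ Set.Icc (0 : ℝ) 1, x + s • h ∈ ω) :
    eLpNorm (fun x => w (x + h) - w x) 2 (volume.restrict A) ≤
      ENNReal.ofReal (‖h‖ * ∑ i, ‖g i‖) := by
  have hAω : A ⊆ ω := fun x hx => by simpa using hA' x hx 0 (by simp)
  have hAh : ∀ x ∈ A, x + h ∈ ω := fun x hx => by simpa using hA' x hx 1 (by simp)
  have hm0 : MemLp (w : Space d → ℝ) 2 (volume.restrict A) :=
    (Lp.memLp w).mono_measure (Measure.restrict_mono hAω le_rfl)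
  have hm1 : MemLp (fun x => w (x + h)) 2 (volume.restrict A) :=
    ((Lp.memLp w).comp_measurePreserving
      ((measurePreserving_add_right volume h).restrict_preimage hω)).mono_measure
      (Measure.restrict_mono hAh le_rfl)
  have hm := hm1.sub hm0
  have key : ‖hm.toLp‖ ≤ ‖h‖ * ∑ i, ‖g i‖ := by
    refine norm_le_of_forall_testFunctions hA _ _ (by positivity) fun φ hφ => ?_
    have h3 : ∀ x, x ∉ A → φ x = 0 := fun x hx =>
      image_eq_zero_of_notMem_tsupport fun hx' => hx (hφ.2.2 hx')
    rw [Lp.norm_toLp]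
    refine le_trans (le_of_eq ?_)
      ((le_abs_self _).trans (abs_integral_mul_translate_sub_le hA.measurableSet hw hA' hφ))
    have hφA := (testFunctions_memLp A φ hφ).1
    have e0 : ∫ x in A, (hm.toLp : Space d → ℝ) x * φ x = ∫ x in A, (w (x + h) * φ x - w x * φ x) := by
      refine integral_congr_ae ?_
      filter_upwards [hm.coeFn_toLp] with x hx
      rw [hx, Pi.sub_apply, sub_mul]
    rw [e0, integral_sub (integrable_mul_of_memLp hm1 hφA) (integrable_mul_of_memLp hm0 hφA)]
    simp_rw [mul_sub]
    have htr : (fun x => φ (x - h)) ∈ testFunctions ω := translate_mem_testFunctions hφ hAh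
    have hφω : φ ∈ testFunctions ω := ⟨hφ.1, hφ.2.1, hφ.2.2.trans hAω⟩
    rw [integral_sub (integrable_mul_of_memLp (Lp.memLp w) (testFunctions_memLp ω _ htr).1)
      (integrable_mul_of_memLp (Lp.memLp w) (testFunctions_memLp ω _ hφω).1)]
    congr 1
    · rw [setIntegral_eq_integral_of_forall_compl_eq_zero fun x hx => by rw [h3 x hx, mul_zero],
        setIntegral_eq_integral_of_forall_compl_eq_zero fun x hx => by
          rw [h3 (x - h) fun hx' => hx (by simpa using hAh _ hx'), mul_zero],
        ← integral_add_right_eq_self (fun x => w x * φ (x - h)) h]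
      simp
    · rw [setIntegral_eq_integral_of_forall_compl_eq_zero fun x hx => by rw [h3 x hx, mul_zero],
        setIntegral_eq_integral_of_forall_compl_eq_zero fun x hx => by
          rw [h3 x fun hx' => hx (hAω hx'), mul_zero]]
  rw [Lp.norm_toLp] at key
  exact (ENNReal.le_ofReal_iff_toReal_le hm.eLpNorm_ne_top (by positivity)).2 key

/-- The mollification of the extension by zero of `w`. -/
def mollify {d : ℕ} (ω : Set (Space d)) (ρ w : Space d → ℝ) (x : Space d) : ℝ :=
  ∫ z, ρ z * ω.indicator w (x - z)

lemma mollify_eq {d : ℕ} {ω : Set (Space d)} (hω : MeasurableSet ω) (ρ w : Space d → ℝ)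
    (x : Space d) : mollify ω ρ w x = ∫ y in ω, w y * ρ (x - y) := by
  rw [mollify, ← integral_sub_left_eq_self (fun z => ρ z * ω.indicator w (x - z)) volume x,
    ← integral_indicator hω]
  refine integral_congr_ae (Eventually.of_forall fun y => ?_)
  by_cases hy : y ∈ ω <;> simp [hy, mul_comm]

lemma isFiniteMeasure_restrict_of_subset {α : Type*} [MeasurableSpace α] {μ : Measure α}
    {A B : Set α} [h : IsFiniteMeasure (μ.restrict B)] (hAB : A ⊆ B) :
    IsFiniteMeasure (μ.restrict A) :=
  ⟨(Measure.restrict_mono hAB le_rfl Set.univ).trans_lt h.measure_univ_lt_top⟩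

lemma memLp_mollifier {d : ℕ} {ω : Set (Space d)} {ρ : Space d → ℝ} (hρ : Continuous ρ)
    (hρs : HasCompactSupport ρ) (x : Space d) :
    MemLp (fun y => ρ (x - y)) 2 (volume.restrict ω) := by
  refine MemLp.restrict ω (MemLp.comp_measurePreserving
    (hρ.memLp_of_hasCompactSupport hρs) (Measure.measurePreserving_sub_left volume x))

section Mollify

variable {d : ℕ} {ω : Set (Space d)} {ρ : Space d → ℝ} {w : Lp ℝ 2 (volume.restrict ω)}

lemma abs_mollify_le (hω : MeasurableSet ω) (hρ : Continuous ρ) (hρs : HasCompactSupport ρ)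
    (x : Space d) : |mollify ω ρ w x| ≤ ‖w‖ * (eLpNorm ρ 2 volume).toReal := by
  rw [mollify_eq hω]
  refine (abs_integral_mul_le w (memLp_mollifier hρ hρs x)).trans ?_
  gcongr
  · exact (hρ.memLp_of_hasCompactSupport hρs).eLpNorm_ne_top
  · refine (eLpNorm_mono_measure _ Measure.restrict_le_self).trans (le_of_eq ?_)
    exact eLpNorm_comp_measurePreserving hρ.aestronglyMeasurable
      (Measure.measurePreserving_sub_left volume x)

variable [IsFiniteMeasure (volume.restrict ω)]

lemma integrable_indicator_coe (hω : MeasurableSet ω) : Integrable (ω.indicator w) volume :=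
  (integrable_indicator_iff hω).2 ((Lp.memLp w).integrable (by norm_num))

lemma integrable_mollify_integrand (hω : MeasurableSet ω) (hρ : Continuous ρ)
    (hρs : HasCompactSupport ρ) :
    Integrable (fun p : Space d × Space d => ρ p.2 * ω.indicator w (p.1 - p.2))
      (volume.prod volume) :=
  (hρ.integrable_of_hasCompactSupport hρs).convolution_integrand
    (ContinuousLinearMap.mul ℝ ℝ) (integrable_indicator_coe hω)

lemma memLp_mollify (hω : MeasurableSet ω) (hρ : Continuous ρ) (hρs : HasCompactSupport ρ)
    {A : Set (Space d)} (hA : A ⊆ ω) : MemLp (mollify ω ρ w) 2 (volume.restrict A) := by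
  have : IsFiniteMeasure (volume.restrict A) := isFiniteMeasure_restrict_of_subset hA
  refine MemLp.of_bound ?_ _ (Eventually.of_forall fun x => abs_mollify_le hω hρ hρs x)
  exact (integrable_mollify_integrand hω hρ hρs).aestronglyMeasurable.integral_prod_right'.restrict

lemma eLpNorm_mollify_sub_le (hω : MeasurableSet ω) (hρ : Continuous ρ)
    (hρs : HasCompactSupport ρ) (hρ0 : ∀ z, 0 ≤ ρ z) (hρ1 : ∫ z, ρ z = 1) {δ : ℝ} (hδ : 0 ≤ δ)
    (hρδ : ∀ z, ρ z ≠ 0 → ‖z‖ ≤ δ) {g : Fin d → Lp ℝ 2 (volume.restrict ω)}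
    (hw : ∀ i, HasWeakPartial (volume.restrict ω) (testFunctions ω) i w (g i))
    {A : Set (Space d)} (hA : IsOpen A) (hA' : ∀ x ∈ A, ∀ z, ‖z‖ ≤ δ → x + z ∈ ω) :
    eLpNorm (fun x => mollify ω ρ w x - w x) 2 (volume.restrict A) ≤
      ENNReal.ofReal (δ * ∑ i, ‖g i‖) := by
  have hAω : A ⊆ ω := fun x hx => by simpa using hA' x hx 0 (by simpa)
  have hm0 : MemLp (w : Space d → ℝ) 2 (volume.restrict A) :=
    (Lp.memLp w).mono_measure (Measure.restrict_mono hAω le_rfl)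
  have hm1 : MemLp (mollify ω ρ w) 2 (volume.restrict A) := memLp_mollify hω hρ hρs hAω
  have hm := hm1.sub hm0
  have hρi : Integrable ρ := hρ.integrable_of_hasCompactSupport hρs
  have key : ‖hm.toLp‖ ≤ δ * ∑ i, ‖g i‖ := by
    refine norm_le_of_forall_testFunctions hA _ _ (by positivity) fun φ hφ => ?_
    have h3 : ∀ x, x ∉ A → φ x = 0 := fun x hx =>
      image_eq_zero_of_notMem_tsupport fun hx' => hx (hφ.2.2 hx')
    rw [Lp.norm_toLp]
    have hφA := (testFunctions_memLp A φ hφ).1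
    have hφω : φ ∈ testFunctions ω := ⟨hφ.1, hφ.2.1, hφ.2.2.trans hAω⟩
    obtain ⟨B, hB⟩ := hφ.2.1.exists_bound_of_continuous hφ.1.continuous
    have hprod : Integrable (fun p : Space d × Space d =>
        ρ p.2 * ω.indicator w (p.1 - p.2) * φ p.1) (volume.prod volume) :=
      (integrable_mollify_integrand hω hρ hρs).mul_bdd (c := B)
        (hφ.1.continuous.comp continuous_fst).aestronglyMeasurable
        (Eventually.of_forall fun p => hB _)
    have e0 : ∫ x in A, (hm.toLp : Space d → ℝ) x * φ x =
        ∫ x in A, (mollify ω ρ w x * φ x - w x * φ x) := by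
      refine integral_congr_ae ?_
      filter_upwards [hm.coeFn_toLp] with x hx
      rw [hx, Pi.sub_apply, sub_mul]
    have e1 : ∫ x in A, mollify ω ρ w x * φ x =
        ∫ z, ρ z * ∫ x in ω, w x * φ (x - -z) := by
      rw [setIntegral_eq_integral_of_forall_compl_eq_zero fun x hx => by rw [h3 x hx, mul_zero]]
      simp_rw [mollify, ← integral_mul_const]
      rw [integral_integral_swap hprod]
      refine integral_congr_ae (Eventually.of_forall fun z => ?_)
      simp only [mul_assoc]
      rw [integral_const_mul, ← integral_indicator hω]
      congr 1
      rw [← integral_sub_right_eq_self (fun x => ω.indicator (fun x => w x * φ (x - -z)) x) z]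
      refine integral_congr_ae (Eventually.of_forall fun x => ?_)
      by_cases hx : x - z ∈ ω <;> simp [hx]
    have e2 : ∫ x in A, w x * φ x = ∫ z, ρ z * ∫ x in ω, w x * φ x := by
      rw [integral_mul_const, hρ1, one_mul,
        setIntegral_eq_integral_of_forall_compl_eq_zero fun x hx => by rw [h3 x hx, mul_zero],
        setIntegral_eq_integral_of_forall_compl_eq_zero fun x hx => by
          rw [h3 x fun hx' => hx (hAω hx'), mul_zero]]
    have hi1 : Integrable (fun z => ρ z * ∫ x in ω, w x * φ (x - -z)) := by
      refine hprod.integral_prod_right.congr (Eventually.of_forall fun z => ?_)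
      simp only [mul_assoc]
      rw [integral_const_mul, ← integral_indicator hω]
      congr 1
      rw [← integral_sub_right_eq_self (fun x => ω.indicator (fun x => w x * φ (x - -z)) x) z]
      refine integral_congr_ae (Eventually.of_forall fun x => ?_)
      by_cases hx : x - z ∈ ω <;> simp [hx]
    rw [e0, integral_sub (integrable_mul_of_memLp hm1 hφA) (integrable_mul_of_memLp hm0 hφA),
      e1, e2, ← integral_sub hi1 (hρi.mul_const _)]
    have hbd : ∀ z, ‖ρ z * (∫ x in ω, w x * φ (x - -z)) - ρ z * ∫ x in ω, w x * φ x‖ ≤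
        ρ z * (δ * (∑ i, ‖g i‖) * (eLpNorm φ 2 (volume.restrict A)).toReal) := by
      intro z
      rw [← mul_sub, norm_mul, Real.norm_of_nonneg (hρ0 z)]
      rcases eq_or_ne (ρ z) 0 with h0 | h0
      · simp [h0]
      have hz := hρδ z h0
      refine mul_le_mul_of_nonneg_left ?_ (hρ0 z)
      have hseg : ∀ x ∈ A, ∀ s ∈ Set.Icc (0 : ℝ) 1, x + s • (-z) ∈ ω := fun x hx s hs => by
        refine hA' x hx _ ?_
        rw [norm_smul, norm_neg, Real.norm_of_nonneg hs.1]
        exact (mul_le_of_le_one_left (norm_nonneg _) hs.2).trans hz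
      have htr : (fun x => φ (x - -z)) ∈ testFunctions ω :=
        translate_mem_testFunctions hφ fun x hx => by simpa using hseg x hx 1 (by simp)
      rw [← integral_sub
        (integrable_mul_of_memLp (Lp.memLp w) (testFunctions_memLp ω _ htr).1)
        (integrable_mul_of_memLp (Lp.memLp w) (testFunctions_memLp ω _ hφω).1)]
      simp_rw [← mul_sub]
      refine (abs_integral_mul_translate_sub_le hA.measurableSet hw hseg hφ).trans ?_
      rw [norm_neg]
      gcongr
    refine (le_abs_self _).trans ((norm_integral_le_of_norm_le
      (hρi.mul_const _) (Eventually.of_forall hbd)).trans (le_of_eq ?_))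
    rw [integral_mul_const, hρ1, one_mul]
  rw [Lp.norm_toLp] at key
  exact (ENNReal.le_ofReal_iff_toReal_le hm.eLpNorm_ne_top (by positivity)).2 key

end Mollify

lemma tendsto_eLpNorm_zero_of_bounded {α : Type*} [MeasurableSpace α] {μ : Measure α}
    [IsFiniteMeasure μ] {f : ℕ → α → ℝ} (hf : ∀ n, AEStronglyMeasurable (f n) μ) (C : ℝ)
    (hC : ∀ n, ∀ᵐ x ∂μ, |f n x| ≤ C) (h : ∀ᵐ x ∂μ, Tendsto (fun n => f n x) atTop (𝓝 0)) :
    Tendsto (fun n => eLpNorm (f n) 2 μ) atTop (𝓝 0) := by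
  have h1 : Tendsto (fun n => ∫⁻ x, ‖f n x‖ₑ ^ (2 : ℝ) ∂μ) atTop (𝓝 (∫⁻ _, 0 ∂μ)) := by
    refine tendsto_lintegral_of_dominated_convergence' (fun _ => ENNReal.ofReal C ^ (2 : ℝ))
      (fun n => (hf n).enorm.pow_const _) (fun n => ?_) ?_ ?_
    · filter_upwards [hC n] with x hx
      refine ENNReal.rpow_le_rpow ?_ (by norm_num)
      rw [Real.enorm_eq_ofReal_abs]
      exact ENNReal.ofReal_le_ofReal hx
    · simp only [lintegral_const]
      exact ENNReal.mul_ne_top (by simp) (measure_ne_top _ _)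
    · filter_upwards [h] with x hx
      have : Tendsto (fun n => ‖f n x‖ₑ ^ (2 : ℝ)) atTop (𝓝 (‖(0 : ℝ)‖ₑ ^ (2 : ℝ))) :=
        (ENNReal.continuous_rpow_const.tendsto _).comp ((continuous_enorm.tendsto _).comp hx)
      simpa using this
  have h2 := (ENNReal.continuous_rpow_const (y := (1 / 2 : ℝ))).tendsto _ |>.comp h1
  simp only [lintegral_zero] at h2
  rw [ENNReal.zero_rpow_of_pos (by norm_num)] at h2
  refine h2.congr fun n => ?_
  rw [eLpNorm_eq_lintegral_rpow_enorm_toReal (by norm_num) (by norm_num)]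
  simp

/-- Interior Rellich theorem. -/
lemma tendsto_eLpNorm_restrict_compact {d : ℕ} {ω : Set (Space d)} (hω : IsOpen ω)
    [IsFiniteMeasure (volume.restrict ω)] {w : ℕ → Lp ℝ 2 (volume.restrict ω)}
    {g : ℕ → Fin d → Lp ℝ 2 (volume.restrict ω)}
    (hw : ∀ n i, HasWeakPartial (volume.restrict ω) (testFunctions ω) i (w n) (g n i)) {C : ℝ}
    (hwC : ∀ n, ‖w n‖ ≤ C) (hgC : ∀ n, ∑ i, ‖g n i‖ ≤ C)
    (hweak : ∀ y, Tendsto (fun n => inner ℝ (w n) y) atTop (𝓝 0))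
    {K : Set (Space d)} (hK : IsCompact K) (hKω : K ⊆ ω) :
    Tendsto (fun n => eLpNorm (w n) 2 (volume.restrict K)) atTop (𝓝 0) := by
  have hC : 0 ≤ C := (norm_nonneg _).trans (hwC 0)
  obtain ⟨r, hr, hrω⟩ := hK.exists_cthickening_subset_open hω hKω
  rw [ENNReal.tendsto_nhds_zero]
  intro η hη
  obtain ⟨η', hη', hη'η⟩ : ∃ η' : ℝ, 0 < η' ∧ ENNReal.ofReal η' ≤ η := by
    rcases eq_or_ne η ⊤ with h | h
    · exact ⟨1, one_pos, h ▸ le_top⟩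
    · exact ⟨η.toReal, ENNReal.toReal_pos hη.ne' h, (ENNReal.ofReal_toReal h).le⟩
  obtain ⟨δ, hδ, hδr, hδη⟩ : ∃ δ : ℝ, 0 < δ ∧ δ ≤ r / 2 ∧ δ * C ≤ η' / 2 := by
    refine ⟨min (r / 2) (η' / 2 / (C + 1)), by positivity, min_le_left _ _, ?_⟩
    calc min (r / 2) (η' / 2 / (C + 1)) * C ≤ η' / 2 / (C + 1) * (C + 1) := by
          gcongr
          · exact min_le_right _ _
          · linarith
      _ = η' / 2 := by field_simp
  set A := Metric.thickening (r / 2) K with hAdef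
  have hA : IsOpen A := Metric.isOpen_thickening
  have hKA : K ⊆ A := Metric.self_subset_thickening (by positivity) K
  have hA' : ∀ x ∈ A, ∀ z, ‖z‖ ≤ δ → x + z ∈ ω := by
    intro x hx z hz
    refine hrω (Metric.thickening_subset_cthickening _ _ ?_)
    rw [hAdef, Metric.mem_thickening_iff] at hx
    obtain ⟨y, hy, hxy⟩ := hx
    refine Metric.mem_thickening_iff.2 ⟨y, hy, ?_⟩
    calc dist (x + z) y ≤ dist (x + z) x + dist x y := dist_triangle _ _ _
      _ < r := by
        have : dist (x + z) x = ‖z‖ := by simp [dist_eq_norm]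
        linarith
  have hAω : A ⊆ ω := fun x hx => by simpa using hA' x hx 0 (by simpa using hδ.le)
  have : IsFiniteMeasure (volume.restrict A) := isFiniteMeasure_restrict_of_subset hAω
  let b : ContDiffBump (0 : Space d) := ⟨δ / 2, δ, by positivity, by linarith⟩
  set ρ := b.normed volume with hρdef
  have hρ : Continuous ρ := b.continuous_normed
  have hρs : HasCompactSupport ρ := b.hasCompactSupport_normed
  have hρδ : ∀ z, ρ z ≠ 0 → ‖z‖ ≤ δ := by
    intro z hz
    have : z ∈ Function.support ρ := hz
    rw [hρdef, b.support_normed_eq] at this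
    simpa using (Metric.mem_ball.1 this).le
  have hmt : Tendsto (fun n => eLpNorm (mollify ω ρ (w n)) 2 (volume.restrict A)) atTop (𝓝 0) := by
    refine tendsto_eLpNorm_zero_of_bounded
      (fun n => (memLp_mollify hω.measurableSet hρ hρs hAω).1)
      (C * (eLpNorm ρ 2 volume).toReal) (fun n => Eventually.of_forall fun x => ?_)
      (Eventually.of_forall fun x => ?_)
    · refine (abs_mollify_le hω.measurableSet hρ hρs x).trans ?_
      gcongr
      exact hwC n
    · have := hweak (memLp_mollifier hρ hρs x).toLp
      simp_rw [inner_toLp] at this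
      simpa only [mollify_eq hω.measurableSet] using this
  rw [ENNReal.tendsto_nhds_zero] at hmt
  filter_upwards [hmt (ENNReal.ofReal (η' / 2)) (by simpa using hη')] with n hn
  refine (eLpNorm_mono_measure _ (Measure.restrict_mono hKA le_rfl)).trans ?_
  have hm0 : MemLp (w n : Space d → ℝ) 2 (volume.restrict A) :=
    (Lp.memLp (w n)).mono_measure (Measure.restrict_mono hAω le_rfl)
  have hm1 : MemLp (mollify ω ρ (w n)) 2 (volume.restrict A) :=
    memLp_mollify hω.measurableSet hρ hρs hAω
  have hsub := eLpNorm_mollify_sub_le hω.measurableSet hρ hρs b.nonneg_normed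
    b.integral_normed hδ.le hρδ (hw n) hA hA'
  have heq : (w n : Space d → ℝ) = mollify ω ρ (w n) - fun x => mollify ω ρ (w n) x - w n x := by
    ext x; simp
  rw [heq]
  refine (eLpNorm_sub_le hm1.1 (hm1.sub hm0).1 (by norm_num)).trans ?_
  calc _ ≤ ENNReal.ofReal (η' / 2) + ENNReal.ofReal (η' / 2) := by
        refine add_le_add hn (hsub.trans (ENNReal.ofReal_le_ofReal ?_))
        exact (mul_le_mul_of_nonneg_left (hgC n) hδ.le).trans hδη
    _ = ENNReal.ofReal η' := by rw [← ENNReal.ofReal_add (by positivity) (by positivity)]; ring_nf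
    _ ≤ η := hη'η

lemma lintegral_biUnion_finset_le {α ι : Type*} [MeasurableSpace α] {μ : Measure α}
    (t : Finset ι) (s : ι → Set α) (f : α → ENNReal) :
    ∫⁻ x in ⋃ i ∈ t, s i, f x ∂μ ≤ ∑ i ∈ t, ∫⁻ x in s i, f x ∂μ := by
  classical
  induction t using Finset.induction_on with
  | empty => simp
  | insert a t ha ih =>
    rw [Finset.set_biUnion_insert, Finset.sum_insert ha]
    exact (lintegral_union_le _ _ _).trans (by gcongr)

/-- Rellich's theorem for domains with the segment property. -/
lemma tendsto_eLpNorm_of_hasSegmentProperty {d : ℕ} {ω : Set (Space d)} (hω : IsOpen ω)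
    (hωb : Bornology.IsBounded ω) (hseg : HasSegmentProperty ω)
    {w : ℕ → Lp ℝ 2 (volume.restrict ω)} {g : ℕ → Fin d → Lp ℝ 2 (volume.restrict ω)}
    (hw : ∀ n i, HasWeakPartial (volume.restrict ω) (testFunctions ω) i (w n) (g n i)) {C : ℝ}
    (hgC : ∀ n, ∑ i, ‖g n i‖ ≤ C)
    (hint : ∀ K : Set (Space d), IsCompact K → K ⊆ ω →
      Tendsto (fun n => eLpNorm (w n) 2 (volume.restrict K)) atTop (𝓝 0)) :
    Tendsto (fun n => eLpNorm (w n) 2 (volume.restrict ω)) atTop (𝓝 0) := by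
  have hC : 0 ≤ C := (Finset.sum_nonneg fun _ _ => norm_nonneg _).trans (hgC 0)
  have : IsFiniteMeasure (volume.restrict ω) := ⟨by simpa using hωb.measure_lt_top⟩
  have hclω : IsCompact (closure ω) := hωb.isCompact_closure
  have hloc : ∀ x₀ ∈ frontier ω, ∃ r > 0,
      Tendsto (fun n => eLpNorm (w n) 2 (volume.restrict (ω ∩ Metric.ball x₀ r))) atTop (𝓝 0) := by
    intro x₀ hx₀
    obtain ⟨r, hr, ξ, hξ⟩ := hseg x₀ hx₀
    refine ⟨r / 2, by positivity, ?_⟩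
    set A := ω ∩ Metric.ball x₀ (r / 2) with hAdef
    have hA : IsOpen A := hω.inter Metric.isOpen_ball
    have hAω : A ⊆ ω := Set.inter_subset_left
    rw [ENNReal.tendsto_nhds_zero]
    intro η hη
    obtain ⟨η', hη', hη'η⟩ : ∃ η' : ℝ, 0 < η' ∧ ENNReal.ofReal η' ≤ η := by
      rcases eq_or_ne η ⊤ with h | h
      · exact ⟨1, one_pos, h ▸ le_top⟩
      · exact ⟨η.toReal, ENNReal.toReal_pos hη.ne' h, (ENNReal.ofReal_toReal h).le⟩
    obtain ⟨t, ht, ht1, htη⟩ : ∃ t : ℝ, 0 < t ∧ t < 1 ∧ t * ‖ξ‖ * C ≤ η' / 2 := by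
      have hD : 0 ≤ ‖ξ‖ * C := by positivity
      refine ⟨min (1 / 2) (η' / 2 / (‖ξ‖ * C + 1)), by positivity,
        (min_le_left _ _).trans_lt (by norm_num), ?_⟩
      calc min (1 / 2) (η' / 2 / (‖ξ‖ * C + 1)) * ‖ξ‖ * C
          = min (1 / 2) (η' / 2 / (‖ξ‖ * C + 1)) * (‖ξ‖ * C) := by ring
        _ ≤ η' / 2 / (‖ξ‖ * C + 1) * (‖ξ‖ * C + 1) := by
            gcongr
            · exact min_le_right _ _
            · linarith
        _ = η' / 2 := by field_simp
    have hA' : ∀ x ∈ A, ∀ s ∈ Set.Icc (0 : ℝ) 1, x + s • (t • ξ) ∈ ω := by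
      intro x hx s hs
      rcases hs.1.eq_or_lt with h0 | h0
      · rw [← h0]; simpa using hAω hx
      rw [smul_smul]
      refine hξ x ⟨subset_closure hx.1, Metric.ball_subset_ball (by linarith) hx.2⟩ _
        ⟨by positivity, ?_⟩
      exact (mul_le_of_le_one_left ht.le hs.2).trans_lt ht1
    set K := (fun x => x + t • ξ) '' (closure ω ∩ Metric.closedBall x₀ (r / 2)) with hKdef
    have hK : IsCompact K :=
      (hclω.inter_right Metric.isClosed_closedBall).image (by fun_prop)
    have hKω : K ⊆ ω := by
      rintro _ ⟨x, hx, rfl⟩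
      exact hξ x ⟨hx.1, Metric.closedBall_subset_ball (by linarith) hx.2⟩ t ⟨ht, ht1⟩
    have hlim := hint K hK hKω
    rw [ENNReal.tendsto_nhds_zero] at hlim
    filter_upwards [hlim (ENNReal.ofReal (η' / 2)) (by simpa using hη')] with n hn
    have hm0 : MemLp (w n : Space d → ℝ) 2 (volume.restrict A) :=
      (Lp.memLp (w n)).mono_measure (Measure.restrict_mono hAω le_rfl)
    have hAK : A ⊆ (fun x => x + t • ξ) ⁻¹' K := fun x hx =>
      ⟨x, ⟨subset_closure hx.1, Metric.ball_subset_closedBall hx.2⟩, rfl⟩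
    have hmp := (measurePreserving_add_right (volume : Measure (Space d))
      (t • ξ)).restrict_preimage hK.measurableSet
    have hmK : MemLp (w n : Space d → ℝ) 2 (volume.restrict K) :=
      (Lp.memLp (w n)).mono_measure (Measure.restrict_mono hKω le_rfl)
    have hm1 : MemLp (fun x => w n (x + t • ξ)) 2 (volume.restrict A) :=
      (hmK.comp_measurePreserving hmp).mono_measure (Measure.restrict_mono hAK le_rfl)
    have hn1 : eLpNorm (fun x => w n (x + t • ξ)) 2 (volume.restrict A) ≤
        ENNReal.ofReal (η' / 2) := by
      refine (eLpNorm_mono_measure _ (Measure.restrict_mono hAK le_rfl)).trans (le_trans ?_ hn)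
      exact (eLpNorm_comp_measurePreserving hmK.1 hmp).le
    have hsub := eLpNorm_translate_sub_le hω.measurableSet hA (hw n) hA'
    have heq : (w n : Space d → ℝ) =
        (fun x => w n (x + t • ξ)) - fun x => w n (x + t • ξ) - w n x := by
      ext x; simp
    rw [heq]
    refine (eLpNorm_sub_le hm1.1 (hm1.sub hm0).1 (by norm_num)).trans ?_
    calc _ ≤ ENNReal.ofReal (η' / 2) + ENNReal.ofReal (η' / 2) := by
          refine add_le_add hn1 (hsub.trans (ENNReal.ofReal_le_ofReal ?_))
          rw [norm_smul, Real.norm_of_nonneg ht.le]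
          exact (mul_le_mul_of_nonneg_left (hgC n) (by positivity)).trans htη
      _ = ENNReal.ofReal η' := by
          rw [← ENNReal.ofReal_add (by positivity) (by positivity)]; ring_nf
      _ ≤ η := hη'η
  choose! r hr hlim using hloc
  have hfc : IsCompact (frontier ω) := hclω.of_isClosed_subset isClosed_frontier
    frontier_subset_closure
  obtain ⟨t, ht, hcover⟩ := hfc.elim_nhds_subcover (fun x => Metric.ball x (r x))
    fun x hx => Metric.ball_mem_nhds x (hr x hx)
  set K := closure ω \ ⋃ x ∈ t, Metric.ball x (r x) with hKdef
  have hK : IsCompact K := hclω.diff (isOpen_biUnion fun _ _ => Metric.isOpen_ball)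
  have hKω : K ⊆ ω := by
    rintro x ⟨hx, hx'⟩
    by_contra hxω
    refine hx' (hcover ?_)
    rw [frontier, hω.interior_eq]
    exact ⟨hx, hxω⟩
  have hsub : ω ⊆ K ∪ ⋃ x ∈ t, (ω ∩ Metric.ball x (r x)) := by
    intro x hx
    by_cases h : x ∈ ⋃ x ∈ t, Metric.ball x (r x)
    · right
      simp only [Set.mem_iUnion] at h ⊢
      obtain ⟨y, hy, hxy⟩ := h
      exact ⟨y, hy, hx, hxy⟩
    · exact Or.inl ⟨subset_closure hx, h⟩
  have hsq : ∀ (A : Set (Space d)) (f : Space d → ℝ),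
      eLpNorm f 2 (volume.restrict A) = (∫⁻ x in A, ‖f x‖ₑ ^ (2 : ℝ)) ^ (1 / 2 : ℝ) := by
    intro A f
    rw [eLpNorm_eq_lintegral_rpow_enorm_toReal (by norm_num) (by norm_num)]
    simp
  have hsq' : ∀ (A : Set (Space d)),
      Tendsto (fun n => eLpNorm (w n) 2 (volume.restrict A)) atTop (𝓝 0) →
      Tendsto (fun n => ∫⁻ x in A, ‖w n x‖ₑ ^ (2 : ℝ)) atTop (𝓝 0) := by
    intro A h
    have := (ENNReal.continuous_rpow_const (y := (2 : ℝ))).tendsto _ |>.comp h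
    rw [ENNReal.zero_rpow_of_pos (by norm_num)] at this
    refine this.congr fun n => ?_
    simp only [Function.comp, hsq]
    rw [← ENNReal.rpow_mul]
    norm_num
  have hsum : Tendsto (fun n => (∫⁻ x in K, ‖w n x‖ₑ ^ (2 : ℝ)) +
      ∑ y ∈ t, ∫⁻ x in ω ∩ Metric.ball y (r y), ‖w n x‖ₑ ^ (2 : ℝ)) atTop (𝓝 0) := by
    have h1 := hsq' K (hint K hK hKω)
    have h2 := tendsto_finsetSum t fun y hy => hsq' _ (hlim y (ht y hy))
    simpa using h1.add h2
  have hfin : Tendsto (fun n => ∫⁻ x in ω, ‖w n x‖ₑ ^ (2 : ℝ)) atTop (𝓝 0) := by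
    refine tendsto_of_tendsto_of_tendsto_of_le_of_le tendsto_const_nhds hsum
      (fun _ => zero_le) fun n => ?_
    refine (lintegral_mono_set hsub).trans ((lintegral_union_le _ _ _).trans ?_)
    gcongr
    exact lintegral_biUnion_finset_le _ _ _
  have := (ENNReal.continuous_rpow_const (y := (1 / 2 : ℝ))).tendsto _ |>.comp hfin
  rw [ENNReal.zero_rpow_of_pos (by norm_num)] at this
  exact this.congr fun n => (hsq ω _).symm

lemma measurableSet_unitCell (d : ℕ) : MeasurableSet (unitCell d) := by
  have : unitCell d = ⋂ i, (fun y : Space d => y i) ⁻¹' Set.Ico (0 : ℝ) 1 := by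
    ext y; simp [unitCell]
  rw [this]
  exact MeasurableSet.iInter fun i => (by fun_prop : Measurable fun y : Space d => y i)
    measurableSet_Ico

lemma unitCell_eq_preimage (d : ℕ) : unitCell d =
    (WithLp.ofLp : Space d → Fin d → ℝ) ⁻¹' Set.univ.pi fun _ => Set.Ico (0 : ℝ) 1 := by
  ext y; simp [unitCell]

lemma volume_unitCell (d : ℕ) : volume (unitCell d) = 1 := by
  rw [unitCell_eq_preimage, (PiLp.volume_preserving_ofLp (Fin d)).measure_preimage
    (MeasurableSet.univ_pi fun _ => measurableSet_Ico).nullMeasurableSet, volume_pi_pi]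
  simp

instance isProbabilityMeasure_unitCell (d : ℕ) :
    IsProbabilityMeasure (volume.restrict (unitCell d)) :=
  ⟨by simp [volume_unitCell]⟩

lemma isBounded_unitCell (d : ℕ) : Bornology.IsBounded (unitCell d) := by
  refine Bornology.IsBounded.subset (IsCompact.isBounded
    ((EuclideanSpace.equiv (Fin d) ℝ).toHomeomorph.isCompact_preimage.2 isCompact_Icc))
    (unitCell_subset d)

lemma exists_bound_unitCell {d : ℕ} {f : Space d → ℝ} (hf : Continuous f) :
    ∃ C, ∀ y ∈ unitCell d, |f y| ≤ C := by
  obtain ⟨C, hC⟩ := ((EuclideanSpace.equiv (Fin d) ℝ).toHomeomorph.isCompact_preimage.2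
    isCompact_Icc).exists_bound_of_continuousOn hf.continuousOn
  exact ⟨C, fun y hy => hC y (unitCell_subset d hy)⟩

/-- The integer vector indexing the cell of `ε ℤ^d` that contains `x`. -/
def cellIndex {d : ℕ} (ε : ℝ) (x : Space d) : Fin d → ℤ := fun i => ⌊x i / ε⌋

/-- An integer vector as a point of `ℝ^d`. -/
def intVec {d : ℕ} (k : Fin d → ℤ) : Space d := WithLp.toLp 2 fun i => (k i : ℝ)

lemma cellCorner_eq {d : ℕ} (ε : ℝ) (x : Space d) :
    cellCorner ε x = ε • intVec (cellIndex ε x) := by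
  ext i; simp [cellCorner, intVec, cellIndex]

lemma measurable_cellIndex {d : ℕ} (ε : ℝ) : Measurable (cellIndex ε : Space d → Fin d → ℤ) := by
  refine measurable_pi_lambda _ fun i => Int.measurable_floor.comp ?_
  fun_prop

lemma cellIndex_eq_iff {d : ℕ} {ε : ℝ} (hε : 0 < ε) (k : Fin d → ℤ) (y : Space d) :
    cellIndex ε (ε • intVec k + ε • y) = k ↔ y ∈ unitCell d := by
  have : ∀ i, (ε • intVec k + ε • y : Space d) i / ε = k i + y i := by
    intro i
    simp only [intVec, PiLp.add_apply, PiLp.smul_apply, smul_eq_mul]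
    field_simp
  simp only [funext_iff, cellIndex, this, unitCell, Set.mem_ofPred_eq, Set.mem_Ico, Int.floor_eq_iff]
  refine forall_congr' fun i => ?_
  constructor <;> rintro ⟨h1, h2⟩ <;> constructor <;> linarith

/-- The map `(x, y) ↦ ε [x/ε] + ε y`. -/
def unfoldMap {d : ℕ} (ε : ℝ) (p : Space d × Space d) : Space d := cellCorner ε p.1 + ε • p.2

lemma measurable_unfoldMap {d : ℕ} (ε : ℝ) :
    Measurable (unfoldMap ε : Space d × Space d → Space d) := by
  have h1 : Measurable (intVec : (Fin d → ℤ) → Space d) := measurable_of_countable _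
  have h2 : Measurable fun p : Space d × Space d => intVec (cellIndex ε p.1) :=
    h1.comp ((measurable_cellIndex ε).comp measurable_fst)
  have : (unfoldMap ε : Space d × Space d → Space d) =
      fun p => ε • intVec (cellIndex ε p.1) + ε • p.2 := by
    ext1 p; rw [unfoldMap, cellCorner_eq]
  rw [this]
  fun_prop

lemma cellIndex_unfoldMap {d : ℕ} {ε : ℝ} (hε : 0 < ε) {p : Space d × Space d}
    (hp : p.2 ∈ unitCell d) : cellIndex ε (unfoldMap ε p) = cellIndex ε p.1 := by
  rw [unfoldMap, cellCorner_eq, cellIndex_eq_iff hε]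
  exact hp

lemma cellCorner_unfoldMap {d : ℕ} {ε : ℝ} (hε : 0 < ε) {p : Space d × Space d}
    (hp : p.2 ∈ unitCell d) : cellCorner ε (unfoldMap ε p) = cellCorner ε p.1 := by
  rw [cellCorner_eq, cellCorner_eq, cellIndex_unfoldMap hε hp]

lemma exists_unitCell_eq {d : ℕ} {ε : ℝ} (hε : 0 < ε) (x : Space d) :
    ∃ y ∈ unitCell d, cellCorner ε x + ε • y = x := by
  refine ⟨ε⁻¹ • (x - cellCorner ε x), ?_, ?_⟩
  · rw [← cellIndex_eq_iff hε (cellIndex ε x), ← cellCorner_eq, smul_smul,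
      mul_inv_cancel₀ hε.ne', one_smul, add_sub_cancel]
  · rw [smul_smul, mul_inv_cancel₀ hε.ne', one_smul, add_sub_cancel]

lemma lintegral_comp_cellIndex {d : ℕ} (μ : Measure (Space d)) (ε : ℝ)
    (G : (Fin d → ℤ) → ENNReal) :
    ∫⁻ x, G (cellIndex ε x) ∂μ = ∑' k, G k * μ (cellIndex ε ⁻¹' {k}) := by
  rw [← lintegral_map (measurable_of_countable G) (measurable_cellIndex ε), lintegral_countable']
  refine tsum_congr fun k => ?_
  rw [Measure.map_apply (measurable_cellIndex ε) (measurableSet_singleton k)]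

lemma volume_cell_inter {d : ℕ} {ε : ℝ} (hε : 0 < ε) (k : Fin d → ℤ) (s : Set (Space d)) :
    volume (unitCell d ∩ {y | ε • intVec k + ε • y ∈ s}) =
      ENNReal.ofReal |(ε ^ Module.finrank ℝ (Space d))⁻¹| *
        volume (s ∩ cellIndex ε ⁻¹' {k}) := by
  have : unitCell d ∩ {y | ε • intVec k + ε • y ∈ s} = (fun y => ε • y) ⁻¹'
      ((fun x => ε • intVec k + x) ⁻¹' (s ∩ cellIndex ε ⁻¹' {k})) := by
    ext y
    simp only [Set.mem_inter_iff, Set.mem_preimage, Set.mem_singleton_iff, cellIndex_eq_iff hε]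
    exact and_comm
  rw [this, Measure.addHaar_preimage_smul _ hε.ne', measure_preimage_add]

lemma measurePreserving_unfoldMap {d : ℕ} {ε : ℝ} (hε : 0 < ε) :
    MeasurePreserving (unfoldMap ε : Space d × Space d → Space d)
      (volume.prod (volume.restrict (unitCell d))) volume := by
  refine ⟨measurable_unfoldMap ε, Measure.ext fun s hs => ?_⟩
  rw [Measure.map_apply (measurable_unfoldMap ε) hs,
    Measure.prod_apply (measurable_unfoldMap ε hs)]
  have h1 : ∀ x : Space d, (volume.restrict (unitCell d)) (Prod.mk x ⁻¹' (unfoldMap ε ⁻¹' s)) =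
      (fun k => volume (unitCell d ∩ {y | ε • intVec k + ε • y ∈ s})) (cellIndex ε x) := by
    intro x
    rw [Measure.restrict_apply' (measurableSet_unitCell d), Set.inter_comm]
    simp only [Set.preimage, unfoldMap, cellCorner_eq, Set.mem_ofPred_eq]
  refine (lintegral_congr h1).trans ((lintegral_comp_cellIndex volume ε
    fun k => volume (unitCell d ∩ {y | ε • intVec k + ε • y ∈ s})).trans ?_)
  have h2 : volume s = ∑' k, 1 * (volume.restrict s) (cellIndex ε ⁻¹' {k}) := by
    rw [← lintegral_comp_cellIndex (volume.restrict s) ε fun _ => 1]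
    simp
  rw [h2]
  refine tsum_congr fun k => ?_
  have hk : MeasurableSet (cellIndex ε ⁻¹' {k} : Set (Space d)) :=
    measurable_cellIndex ε (measurableSet_singleton k)
  have h3 := volume_cell_inter hε k Set.univ
  simp only [Set.mem_univ, Set.univ_inter] at h3
  rw [Set.ofPred_true, Set.inter_univ, volume_unitCell] at h3
  rw [volume_cell_inter hε, Measure.restrict_apply hk, one_mul, mul_right_comm, ← h3, one_mul,
    Set.inter_comm]

/-- The union of the cells of `ε ℤ^d` that are contained in `ω`. -/
def interiorCells {d : ℕ} (ω : Set (Space d)) (ε : ℝ) : Set (Space d) :=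
  {x | ∀ y ∈ unitCell d, cellCorner ε x + ε • y ∈ ω}

lemma measurableSet_interiorCells {d : ℕ} (ω : Set (Space d)) (ε : ℝ) :
    MeasurableSet (interiorCells ω ε) := by
  have : interiorCells ω ε =
      cellIndex ε ⁻¹' {k | ∀ y ∈ unitCell d, ε • intVec k + ε • y ∈ ω} := by
    ext x; simp [interiorCells, cellCorner_eq]
  rw [this]
  exact measurable_cellIndex ε (Set.to_countable _).measurableSet

lemma interiorCells_subset {d : ℕ} {ω : Set (Space d)} {ε : ℝ} (hε : 0 < ε) :
    interiorCells ω ε ⊆ ω := by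
  intro x hx
  obtain ⟨y, hy, h⟩ := exists_unitCell_eq hε x
  exact h ▸ hx y hy

lemma unfoldMap_mem_interiorCells {d : ℕ} {ω : Set (Space d)} {ε : ℝ} (hε : 0 < ε)
    {p : Space d × Space d} (hp : p.2 ∈ unitCell d) :
    unfoldMap ε p ∈ interiorCells ω ε ↔ p.1 ∈ interiorCells ω ε := by
  rw [interiorCells, Set.mem_ofPred_eq, Set.mem_ofPred_eq, cellCorner_unfoldMap hε hp]

lemma unfolding_eq_indicator {d : ℕ} (ω : Set (Space d)) (ε : ℝ) (v : Space d → ℝ) :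
    unfolding ω ε v = (interiorCells ω ε ×ˢ Set.univ).indicator (v ∘ unfoldMap ε) := by
  classical
  ext p
  simp only [unfolding, Set.indicator, interiorCells, Set.mem_prod, Set.mem_univ, and_true,
    Set.mem_ofPred_eq, Function.comp, unfoldMap]

lemma ae_cellMeasure {d : ℕ} {ω : Set (Space d)} (hω : MeasurableSet ω) :
    ∀ᵐ p ∂(cellMeasure ω), p.1 ∈ ω ∧ p.2 ∈ unitCell d := by
  rw [cellMeasure, Measure.prod_restrict]
  exact ae_restrict_mem (hω.prod (measurableSet_unitCell d))

lemma cellMeasure_restrict {d : ℕ} {ω : Set (Space d)} {ε : ℝ} (hε : 0 < ε) :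
    (cellMeasure ω).restrict (interiorCells ω ε ×ˢ Set.univ) =
      (volume.restrict (interiorCells ω ε)).prod (volume.restrict (unitCell d)) := by
  rw [cellMeasure, ← Measure.prod_restrict, Measure.restrict_univ,
    Measure.restrict_restrict (measurableSet_interiorCells ω ε),
    Set.inter_eq_left.2 (interiorCells_subset hε)]

lemma measurePreserving_unfoldMap_restrict {d : ℕ} (ω : Set (Space d)) {ε : ℝ} (hε : 0 < ε) :
    MeasurePreserving (unfoldMap ε)
      ((cellMeasure ω).restrict (interiorCells ω ε ×ˢ Set.univ))
      (volume.restrict (interiorCells ω ε)) := by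
  have := (measurePreserving_unfoldMap (d := d) hε).restrict_preimage
    (measurableSet_interiorCells ω ε)
  convert! this using 1
  rw [cellMeasure_restrict hε]
  conv_lhs => rw [← Measure.restrict_univ (μ := volume.restrict (unitCell d)),
    Measure.prod_restrict]
  refine Measure.restrict_congr_set ?_
  have h : ∀ᵐ p ∂((volume : Measure (Space d)).prod (volume.restrict (unitCell d))),
      p.2 ∈ unitCell d := by
    have := ae_cellMeasure (d := d) MeasurableSet.univ
    rw [cellMeasure, Measure.restrict_univ] at this
    exact this.mono fun p hp => hp.2
  filter_upwards [h] with p hp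
  refine propext ?_
  change p ∈ interiorCells ω ε ×ˢ Set.univ ↔ unfoldMap ε p ∈ interiorCells ω ε
  rw [unfoldMap_mem_interiorCells hε hp]
  simp

lemma measurableSet_interiorCells_prod {d : ℕ} (ω : Set (Space d)) (ε : ℝ) :
    MeasurableSet (interiorCells ω ε ×ˢ (Set.univ : Set (Space d))) :=
  (measurableSet_interiorCells ω ε).prod MeasurableSet.univ

lemma eLpNorm_unfolding {d : ℕ} (ω : Set (Space d)) {ε : ℝ} (hε : 0 < ε) {f : Space d → ℝ}
    (hf : StronglyMeasurable f) : eLpNorm (unfolding ω ε f) 2 (cellMeasure ω) =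
      eLpNorm f 2 (volume.restrict (interiorCells ω ε)) := by
  rw [unfolding_eq_indicator, eLpNorm_indicator_eq_eLpNorm_restrict
    (measurableSet_interiorCells_prod ω ε)]
  exact eLpNorm_comp_measurePreserving hf.aestronglyMeasurable
    (measurePreserving_unfoldMap_restrict ω hε)

lemma stronglyMeasurable_unfolding {d : ℕ} (ω : Set (Space d)) (ε : ℝ) {f : Space d → ℝ}
    (hf : StronglyMeasurable f) : StronglyMeasurable (unfolding ω ε f) := by
  rw [unfolding_eq_indicator]
  exact (hf.comp_measurable (measurable_unfoldMap ε)).indicator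
    (measurableSet_interiorCells_prod ω ε)

lemma eLpNorm_unfolding_le {d : ℕ} {ω : Set (Space d)} {ε : ℝ} (hε : 0 < ε)
    (f : Lp ℝ 2 (volume.restrict ω)) :
    eLpNorm (unfolding ω ε f) 2 (cellMeasure ω) ≤ eLpNorm f 2 (volume.restrict ω) := by
  rw [eLpNorm_unfolding ω hε (Lp.stronglyMeasurable f)]
  exact eLpNorm_mono_measure _ (Measure.restrict_mono (interiorCells_subset hε) le_rfl)

lemma memLp_unfolding {d : ℕ} {ω : Set (Space d)} {ε : ℝ} (hε : 0 < ε)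
    (f : Lp ℝ 2 (volume.restrict ω)) : MemLp (unfolding ω ε f) 2 (cellMeasure ω) :=
  ⟨(stronglyMeasurable_unfolding ω ε (Lp.stronglyMeasurable f)).aestronglyMeasurable,
    (eLpNorm_unfolding_le hε f).trans_lt (Lp.memLp f).eLpNorm_lt_top⟩

lemma norm_toLp_unfolding_le {d : ℕ} {ω : Set (Space d)} {ε : ℝ} (hε : 0 < ε)
    (f : Lp ℝ 2 (volume.restrict ω)) : ‖(memLp_unfolding hε f).toLp‖ ≤ ‖f‖ := by
  rw [Lp.norm_toLp, Lp.norm_def]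
  exact ENNReal.toReal_mono (Lp.memLp f).eLpNorm_ne_top (eLpNorm_unfolding_le hε f)

/-- The exact integration formula for the unfolding operator. -/
lemma integral_unfolding {d : ℕ} (ω : Set (Space d)) {ε : ℝ} (hε : 0 < ε) {F : Space d → ℝ}
    (hF : StronglyMeasurable F) :
    ∫ p, unfolding ω ε F p ∂(cellMeasure ω) = ∫ x in interiorCells ω ε, F x := by
  rw [unfolding_eq_indicator, integral_indicator (measurableSet_interiorCells_prod ω ε),
    ← (measurePreserving_unfoldMap_restrict ω hε).map_eq,
    integral_map (measurable_unfoldMap ε).aemeasurable hF.aestronglyMeasurable]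
  rfl

lemma unfolding_mul {d : ℕ} (ω : Set (Space d)) (ε : ℝ) (f g : Space d → ℝ)
    (p : Space d × Space d) :
    unfolding ω ε (fun x => f x * g x) p = unfolding ω ε f p * unfolding ω ε g p := by
  unfold unfolding
  split_ifs <;> simp

lemma periodic_intVec {d : ℕ} {χ : Space d → ℝ}
    (h : ∀ (i : Fin d) (x : Space d), χ (x + EuclideanSpace.single i 1) = χ x) (k : Fin d → ℤ) :
    Function.Periodic χ (intVec k) := by
  have hk : intVec k = ∑ i, k i • (EuclideanSpace.single i (1 : ℝ) : Space d) := by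
    ext j
    simp [intVec, Finset.sum_apply, Pi.single_apply]
  rw [hk]
  refine Finset.sum_induction _ (Function.Periodic χ) (fun _ _ => Function.Periodic.add_period)
    (fun x => by simp) fun i _ => Function.Periodic.zsmul (h i) _

lemma periodic_scaled_unfoldMap {d : ℕ} {χ : Space d → ℝ}
    (h : ∀ (i : Fin d) (x : Space d), χ (x + EuclideanSpace.single i 1) = χ x) {ε : ℝ}
    (hε : 0 < ε) (p : Space d × Space d) : χ (ε⁻¹ • unfoldMap ε p) = χ p.2 := by
  rw [unfoldMap, cellCorner_eq, ← smul_add, smul_smul, inv_mul_cancel₀ hε.ne', one_smul, add_comm]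
  exact periodic_intVec h _ _

lemma unfolding_of_mem {d : ℕ} {ω : Set (Space d)} {ε : ℝ} {p : Space d × Space d}
    (h : p.1 ∈ interiorCells ω ε) (v : Space d → ℝ) : unfolding ω ε v p = v (unfoldMap ε p) := by
  classical exact if_pos h

instance isFiniteMeasure_cellMeasure {d : ℕ} (ω : Set (Space d))
    [IsFiniteMeasure (volume.restrict ω)] : IsFiniteMeasure (cellMeasure ω) := by
  unfold cellMeasure; infer_instance

lemma exists_dist_unfoldMap_le (d : ℕ) : ∃ D : ℝ, ∀ ε : ℝ, 0 < ε → ∀ (x y : Space d),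
    y ∈ unitCell d → dist (unfoldMap ε (x, y)) x ≤ ε * D := by
  obtain ⟨D, hD⟩ := Metric.isBounded_iff.1 (isBounded_unitCell d)
  refine ⟨D, fun ε hε x y hy => ?_⟩
  obtain ⟨y', hy', h⟩ := exists_unitCell_eq hε x
  have e : dist (unfoldMap ε (x, y)) x =
      dist (cellCorner ε x + ε • y) (cellCorner ε x + ε • y') := by rw [h]; rfl
  rw [e, dist_add_left, dist_smul₀, Real.norm_of_nonneg hε.le]
  exact mul_le_mul_of_nonneg_left (hD hy hy') hε.le

section Limits

variable {d : ℕ} {ω : Set (Space d)} {ε : ℕ → ℝ}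

lemma eventually_subset_interiorCells (hω : IsOpen ω) (hε_pos : ∀ n, 0 < ε n)
    (hε : Tendsto ε atTop (𝓝 0)) {K : Set (Space d)} (hK : IsCompact K) (hKω : K ⊆ ω) :
    ∀ᶠ n in atTop, K ⊆ interiorCells ω (ε n) := by
  obtain ⟨D, hD⟩ := exists_dist_unfoldMap_le d
  obtain ⟨δ, hδ, hδω⟩ := hK.exists_cthickening_subset_open hω hKω
  have : Tendsto (fun n => ε n * D) atTop (𝓝 0) := by simpa using hε.mul_const D
  filter_upwards [this.eventually_lt_const hδ] with n hn x hx y hy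
  exact hδω (Metric.mem_cthickening_of_dist_le _ x δ K hx ((hD _ (hε_pos n) x y hy).trans hn.le))

lemma tendsto_unfolding (hω : IsOpen ω) (hε_pos : ∀ n, 0 < ε n) (hε : Tendsto ε atTop (𝓝 0))
    {ψ : Space d → ℝ} (hψ : Continuous ψ) {p : Space d × Space d} (hp1 : p.1 ∈ ω)
    (hp2 : p.2 ∈ unitCell d) :
    Tendsto (fun n => unfolding ω (ε n) ψ p) atTop (𝓝 (ψ p.1)) := by
  obtain ⟨D, hD⟩ := exists_dist_unfoldMap_le d
  have h0 : Tendsto (fun n => ε n * D) atTop (𝓝 0) := by simpa using hε.mul_const D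
  have h1 : Tendsto (fun n => unfoldMap (ε n) p) atTop (𝓝 p.1) :=
    tendsto_iff_dist_tendsto_zero.2 (squeeze_zero (fun _ => dist_nonneg)
      (fun n => hD _ (hε_pos n) p.1 p.2 hp2) h0)
  refine ((hψ.tendsto _).comp h1).congr' ?_
  filter_upwards [eventually_subset_interiorCells hω hε_pos hε isCompact_singleton
    (Set.singleton_subset_iff.2 hp1)] with n hn
  rw [unfolding_of_mem (hn rfl)]
  rfl

variable [IsFiniteMeasure (volume.restrict ω)]

lemma memLp_mul_cell (hω : IsOpen ω) {ψ χ : Space d → ℝ} (hψ : Continuous ψ)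
    (hψs : HasCompactSupport ψ) (hχ : Continuous χ) :
    MemLp (fun p : Space d × Space d => ψ p.1 * χ p.2) 2 (cellMeasure ω) := by
  obtain ⟨B, hB⟩ := hψs.exists_bound_of_continuous hψ
  obtain ⟨C, hC⟩ := exists_bound_unitCell hχ
  refine MemLp.of_bound (Continuous.aestronglyMeasurable (by fun_prop)) (B * C) ?_
  filter_upwards [ae_cellMeasure hω.measurableSet] with p hp
  rw [norm_mul]
  exact mul_le_mul (hB _) (hC _ hp.2) (norm_nonneg _) ((norm_nonneg _).trans (hB 0))

/-- Passing to the limit in products with an oscillating test function. -/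
lemma tendsto_integral_oscillating (hω : IsOpen ω) (hε_pos : ∀ n, 0 < ε n)
    (hε : Tendsto ε atTop (𝓝 0)) {f : ℕ → Lp ℝ 2 (volume.restrict ω)} {C : ℝ}
    (hf : ∀ n, ‖f n‖ ≤ C) {Ξ : Lp ℝ 2 (cellMeasure ω)}
    (hΞ : ∀ y, Tendsto (fun n => inner ℝ (memLp_unfolding (hε_pos n) (f n)).toLp y) atTop
      (𝓝 (inner ℝ Ξ y)))
    {ψ χ : Space d → ℝ} (hψ : Continuous ψ) (hψs : HasCompactSupport ψ) (hψω : tsupport ψ ⊆ ω)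
    (hχ : Continuous χ)
    (hper : ∀ (i : Fin d) (x : Space d), χ (x + EuclideanSpace.single i 1) = χ x) :
    Tendsto (fun n => ∫ x in ω, f n x * (ψ x * χ ((ε n)⁻¹ • x))) atTop
      (𝓝 (∫ p, Ξ p * (ψ p.1 * χ p.2) ∂(cellMeasure ω))) := by
  have hq := memLp_mul_cell hω hψ hψs hχ
  obtain ⟨B, hB⟩ := hψs.exists_bound_of_continuous hψ
  obtain ⟨B', hB'⟩ := exists_bound_unitCell hχ
  have hB0 : 0 ≤ B := (norm_nonneg _).trans (hB 0)
  set r : ℕ → Space d × Space d → ℝ := fun n p => (unfolding ω (ε n) ψ p - ψ p.1) * χ p.2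
    with hr
  have hTψ : ∀ n p, |unfolding ω (ε n) ψ p| ≤ B := by
    intro n p
    unfold unfolding
    split_ifs
    · exact hB _
    · simpa using hB0
  have hrm : ∀ n, AEStronglyMeasurable (r n) (cellMeasure ω) := fun n =>
    (((stronglyMeasurable_unfolding ω (ε n) hψ.stronglyMeasurable).aestronglyMeasurable.sub
      (hψ.comp continuous_fst).aestronglyMeasurable).mul
        (hχ.comp continuous_snd).aestronglyMeasurable)
  have hrb : ∀ n, ∀ᵐ p ∂(cellMeasure ω), |r n p| ≤ (B + B) * B' := by
    intro n
    filter_upwards [ae_cellMeasure hω.measurableSet] with p hp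
    rw [hr, abs_mul]
    refine mul_le_mul ((abs_sub _ _).trans (add_le_add (hTψ n p) (hB _))) (hB' _ hp.2)
      (abs_nonneg _) (by positivity)
  have hrL : ∀ n, MemLp (r n) 2 (cellMeasure ω) := fun n => MemLp.of_bound (hrm n) _ (hrb n)
  have hr0 : Tendsto (fun n => eLpNorm (r n) 2 (cellMeasure ω)) atTop (𝓝 0) := by
    refine tendsto_eLpNorm_zero_of_bounded hrm _ hrb ?_
    filter_upwards [ae_cellMeasure hω.measurableSet] with p hp
    simpa [hr] using ((tendsto_unfolding hω hε_pos hε hψ hp.1 hp.2).sub_const (ψ p.1)).mul_const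
      (χ p.2)
  have h1 := hΞ hq.toLp
  simp_rw [inner_toLp] at h1
  have h2 : Tendsto (fun n => ∫ p, ((memLp_unfolding (hε_pos n) (f n)).toLp : Space d × Space d → ℝ) p * r n p
      ∂(cellMeasure ω)) atTop (𝓝 0) := by
    refine squeeze_zero_norm (a := fun n => C * (eLpNorm (r n) 2 (cellMeasure ω)).toReal)
      (fun n => ?_) ?_
    · refine (abs_integral_mul_le _ (hrL n)).trans ?_
      gcongr
      exact (norm_toLp_unfolding_le (hε_pos n) (f n)).trans (hf n)
    · simpa using ((ENNReal.tendsto_toReal (by simp)).comp hr0).const_mul C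
  have h3 := h1.add h2
  rw [add_zero] at h3
  refine h3.congr' ?_
  filter_upwards [eventually_subset_interiorCells hω hε_pos hε hψs hψω] with n hn
  rw [← integral_add (integrable_mul_of_memLp (Lp.memLp _) hq)
    (integrable_mul_of_memLp (Lp.memLp _) (hrL n))]
  have e1 : ∫ x in ω, f n x * (ψ x * χ ((ε n)⁻¹ • x)) =
      ∫ x in interiorCells ω (ε n), f n x * (ψ x * χ ((ε n)⁻¹ • x)) := by
    rw [setIntegral_eq_integral_of_forall_compl_eq_zero,
      setIntegral_eq_integral_of_forall_compl_eq_zero]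
    · intro x hx
      rw [image_eq_zero_of_notMem_tsupport fun h => hx (hn h)]; ring
    · intro x hx
      rw [image_eq_zero_of_notMem_tsupport fun h => hx (hψω h)]; ring
  rw [e1, ← integral_unfolding ω (hε_pos n)]
  · refine integral_congr_ae ?_
    filter_upwards [(memLp_unfolding (hε_pos n) (f n)).coeFn_toLp] with p hp
    rw [hp, unfolding_mul, unfolding_mul, hr]
    by_cases h : p.1 ∈ interiorCells ω (ε n)
    · have : unfolding ω (ε n) (fun x => χ ((ε n)⁻¹ • x)) p = χ p.2 := by
        rw [unfolding_of_mem h]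
        exact periodic_scaled_unfoldMap hper (hε_pos n) p
      rw [this]
      ring
    · have : unfolding ω (ε n) (f n) p = 0 := by
        rw [unfolding_eq_indicator, Set.indicator_of_notMem fun h' => h h'.1]
      rw [this]
      ring
  · exact (Lp.stronglyMeasurable (f n)).mul
      (hψ.mul (hχ.comp (continuous_const_smul _))).stronglyMeasurable

lemma integrable_cell_mul {Ξ : Lp ℝ 2 (cellMeasure ω)} (hω : IsOpen ω) {χ : Space d → ℝ}
    (hχ : Continuous χ) : Integrable (fun p => Ξ p * χ p.2) (cellMeasure ω) := by
  obtain ⟨C, hC⟩ := exists_bound_unitCell hχ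
  refine ((Lp.memLp Ξ).integrable (by norm_num)).mul_bdd (c := C)
    (hχ.comp continuous_snd).aestronglyMeasurable ?_
  filter_upwards [ae_cellMeasure hω.measurableSet] with p hp using hC _ hp.2

/-- Disintegration of an identity tested with products. -/
lemma ae_integral_cell_eq (hω : IsOpen ω) {Ξ : Lp ℝ 2 (cellMeasure ω)} {χ : Space d → ℝ}
    (hχ : Continuous χ) {G : Space d → ℝ} (hG : Integrable G (volume.restrict ω))
    (h : ∀ ψ ∈ testFunctions ω,
      ∫ p, Ξ p * (ψ p.1 * χ p.2) ∂(cellMeasure ω) = ∫ x in ω, G x * ψ x) :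
    ∀ᵐ x ∂(volume.restrict ω), ∫ y in unitCell d, Ξ (x, y) * χ y = G x := by
  have hi := integrable_cell_mul (Ξ := Ξ) hω hχ
  have hi' : Integrable (fun x => ∫ y in unitCell d, Ξ (x, y) * χ y) (volume.restrict ω) :=
    hi.integral_prod_left
  have hloc : LocallyIntegrableOn (fun x => (∫ y in unitCell d, Ξ (x, y) * χ y) - G x) ω
      (volume.restrict ω) := (hi'.sub hG).locallyIntegrable.locallyIntegrableOn ω
  have := hω.ae_eq_zero_of_integral_contDiff_smul_eq_zero hloc (fun ψ h1 h2 h3 => by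
    have hψ : ψ ∈ testFunctions ω := ⟨h1, h2, h3⟩
    obtain ⟨B, hB⟩ := h2.exists_bound_of_continuous h1.continuous
    have hm : ∀ {F : Space d → ℝ}, Integrable F (volume.restrict ω) →
        Integrable (fun x => F x * ψ x) (volume.restrict ω) := fun hF =>
      hF.mul_bdd (c := B) h1.continuous.aestronglyMeasurable (Eventually.of_forall hB)
    have hprod : Integrable (fun p => Ξ p * (ψ p.1 * χ p.2))
        ((volume.restrict ω).prod (volume.restrict (unitCell d))) :=
      integrable_mul_of_memLp (Lp.memLp Ξ) (memLp_mul_cell hω h1.continuous h2 hχ)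
    have e := h ψ hψ
    have e' := integral_prod _ hprod
    have e1 : ∀ x, ψ x • ((∫ y in unitCell d, Ξ (x, y) * χ y) - G x) =
        (∫ y in unitCell d, Ξ (x, y) * χ y) * ψ x - G x * ψ x := fun x => by
      rw [smul_eq_mul]; ring
    simp_rw [e1]
    rw [integral_sub (hm hi') (hm hG), ← e, sub_eq_zero]
    refine Eq.trans ?_ e'.symm
    refine integral_congr_ae (Eventually.of_forall fun x => ?_)
    simp only
    rw [← integral_mul_const]
    refine integral_congr_ae (Eventually.of_forall fun y => ?_)
    simp only
    ring)
  filter_upwards [this, ae_restrict_mem hω.measurableSet] with x hx hxω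
  exact sub_eq_zero.1 (hx hxω)

end Limits

section Calculus

variable {d : ℕ} {φ ψ χ : Space d → ℝ}

lemma contDiff_partialDeriv (h : ContDiff ℝ (⊤ : ℕ∞) φ) (i : Fin d) :
    ContDiff ℝ (⊤ : ℕ∞) (partialDeriv i φ) :=
  (h.fderiv_right (m := (⊤ : ℕ∞)) (by simp)).clm_apply contDiff_const

lemma partialDeriv_comm (h : ContDiff ℝ (⊤ : ℕ∞) φ) (i j : Fin d) :
    partialDeriv i (partialDeriv j φ) = partialDeriv j (partialDeriv i φ) := by
  have hd : Differentiable ℝ (fderiv ℝ φ) :=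
    (h.fderiv_right (m := (⊤ : ℕ∞)) (by simp)).differentiable (by simp)
  have e : ∀ (a b : Fin d) (x : Space d), partialDeriv a (partialDeriv b φ) x =
      fderiv ℝ (fderiv ℝ φ) x (EuclideanSpace.single a 1) (EuclideanSpace.single b 1) := by
    intro a b x
    have h1 : HasFDerivAt (fun y => fderiv ℝ φ y (EuclideanSpace.single b 1))
        ((fderiv ℝ (fderiv ℝ φ) x).flip (EuclideanSpace.single b 1)) x := by
      simpa using (hd x).hasFDerivAt.clm_apply (hasFDerivAt_const (EuclideanSpace.single b 1) x)
    change fderiv ℝ (fun y => fderiv ℝ φ y (EuclideanSpace.single b 1)) x _ = _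
    rw [h1.fderiv]
    rfl
  ext x
  rw [e, e]
  exact second_derivative_symmetric (fun y => (h.differentiable (by simp) y).hasFDerivAt)
    (hd x).hasFDerivAt _ _

lemma partialDeriv_mul (hψ : ContDiff ℝ (⊤ : ℕ∞) ψ) (hχ : ContDiff ℝ (⊤ : ℕ∞) χ) (i : Fin d) :
    partialDeriv i (fun x => ψ x * χ x) =
      fun x => partialDeriv i ψ x * χ x + ψ x * partialDeriv i χ x := by
  ext x
  simp only [partialDeriv]
  rw [fderiv_fun_mul (hψ.differentiable (by simp) x) (hχ.differentiable (by simp) x)]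
  simp only [add_apply, smul_apply, smul_eq_mul]
  ring

lemma partialDeriv_add (hψ : ContDiff ℝ (⊤ : ℕ∞) ψ) (hχ : ContDiff ℝ (⊤ : ℕ∞) χ) (i : Fin d) :
    partialDeriv i (fun x => ψ x + χ x) = fun x => partialDeriv i ψ x + partialDeriv i χ x := by
  ext x
  simp only [partialDeriv]
  rw [fderiv_fun_add (hψ.differentiable (by simp) x) (hχ.differentiable (by simp) x)]
  simp

lemma partialDeriv_const_mul (hψ : ContDiff ℝ (⊤ : ℕ∞) ψ) (c : ℝ) (i : Fin d) :
    partialDeriv i (fun x => c * ψ x) = fun x => c * partialDeriv i ψ x := by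
  ext x
  simp only [partialDeriv]
  rw [fderiv_const_mul (hψ.differentiable (by simp) x)]
  simp

lemma partialDeriv_comp_smul (χ : Space d → ℝ) (c : ℝ) (i : Fin d) :
    partialDeriv i (fun x => χ (c • x)) = fun x => c * partialDeriv i χ (c • x) := by
  ext x
  simp only [partialDeriv]
  rw [fderiv_comp_smul]
  simp

lemma partialDeriv_mem_testFunctions {ω : Set (Space d)} (h : φ ∈ testFunctions ω) (i : Fin d) :
    partialDeriv i φ ∈ testFunctions ω := by
  have hs : Function.support (partialDeriv i φ) ⊆ Function.support (fderiv ℝ φ) := by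
    intro x hx hx'
    exact hx (by simp [partialDeriv, hx'])
  have ht : tsupport (partialDeriv i φ) ⊆ tsupport φ :=
    (closure_mono hs).trans (tsupport_fderiv_subset ℝ)
  exact ⟨contDiff_partialDeriv h.1 i, h.2.1.of_isClosed_subset (isClosed_tsupport _) ht,
    ht.trans h.2.2⟩

lemma partialDeriv_mem_periodicTestFunctions (h : φ ∈ periodicTestFunctions d) (i : Fin d) :
    partialDeriv i φ ∈ periodicTestFunctions d := by
  refine ⟨contDiff_partialDeriv h.1 i, fun j x => ?_⟩
  have : (fun y => φ (y + EuclideanSpace.single j 1)) = φ := funext (h.2 j)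
  rw [partialDeriv, ← fderiv_comp_add_right, this, partialDeriv]

lemma mul_mem_testFunctions {ω : Set (Space d)} (hψ : ψ ∈ testFunctions ω)
    (hχ : ContDiff ℝ (⊤ : ℕ∞) χ) : (fun x => ψ x * χ x) ∈ testFunctions ω := by
  refine ⟨hψ.1.mul hχ, hψ.2.1.mul_right, ?_⟩
  exact (tsupport_mul_subset_left (f := ψ) (g := χ)).trans hψ.2.2

/-- Fourth order symmetry of second weak derivatives. -/
lemma integral_hess_symm {μ : Measure (Space d)} {T : Set (Space d → ℝ)}
    {hT : ∀ φ ∈ T, MemLp φ 2 μ ∧ ∀ i, MemLp (partialDeriv i φ) 2 μ}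
    (hT' : ∀ φ ∈ T, ContDiff ℝ (⊤ : ℕ∞) φ ∧ ∀ i, partialDeriv i φ ∈ T) {J : Jet μ}
    (hJ : J ∈ weakH2 μ T hT) {Z : Space d → ℝ} (hZ : Z ∈ T) (i j l m : Fin d) :
    ∫ x, J.hess i j x * partialDeriv l (partialDeriv m Z) x ∂μ =
      ∫ x, J.hess l m x * partialDeriv i (partialDeriv j Z) x ∂μ := by
  have key : ∀ i j l m : Fin d, ∫ x, J.hess i j x * partialDeriv l (partialDeriv m Z) x ∂μ =
      ∫ x, J.val x * partialDeriv i (partialDeriv j (partialDeriv l (partialDeriv m Z))) x ∂μ := by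
    intro i j l m
    have h1 := (hT' _ ((hT' Z hZ).2 m)).2 l
    have h2 := (hT' _ h1).2 j
    have e1 := hJ.2 i j _ h1
    have e2 := hJ.1 i _ h2
    rw [e2, e1, neg_neg]
  rw [key, key]
  have hs : ∀ {f}, f ∈ T → ContDiff ℝ (⊤ : ℕ∞) f := fun hf => (hT' _ hf).1
  have hp : ∀ {f} (a : Fin d), f ∈ T → partialDeriv a f ∈ T := fun a hf => (hT' _ hf).2 a
  rw [partialDeriv_comm (hs (hp m hZ)) j l, partialDeriv_comm (hs (hp j (hp m hZ))) i l,
    partialDeriv_comm (hs hZ) j m, partialDeriv_comm (hs (hp j hZ)) i m]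

end Calculus

lemma integral_add_three_const_mul {α : Type*} [MeasurableSpace α] {μ : Measure α}
    {f₁ f₂ f₃ f₄ : α → ℝ} (h₁ : Integrable f₁ μ) (h₂ : Integrable f₂ μ) (h₃ : Integrable f₃ μ)
    (h₄ : Integrable f₄ μ) {a b c : ℝ} :
    ∫ x, (f₁ x + a * f₂ x + b * f₃ x + c * f₄ x) ∂μ =
      ∫ x, f₁ x ∂μ + a * ∫ x, f₂ x ∂μ + b * ∫ x, f₃ x ∂μ + c * ∫ x, f₄ x ∂μ := by
  have h12 : Integrable (fun x => f₁ x + a * f₂ x) μ := h₁.add (h₂.const_mul a)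
  have h123 : Integrable (fun x => f₁ x + a * f₂ x + b * f₃ x) μ := h12.add (h₃.const_mul b)
  rw [integral_add h123 (h₄.const_mul c), integral_add h12 (h₃.const_mul b),
    integral_add h₁ (h₂.const_mul a), integral_const_mul, integral_const_mul, integral_const_mul]

section Compatibility

variable {d : ℕ} {ω : Set (Space d)} [IsFiniteMeasure (volume.restrict ω)] {ε : ℕ → ℝ}

lemma tendsto_integral_partialDeriv_oscillating (hω : IsOpen ω) (hε_pos : ∀ n, 0 < ε n)
    (hε : Tendsto ε atTop (𝓝 0)) {f : ℕ → Lp ℝ 2 (volume.restrict ω)} {C : ℝ}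
    (hf : ∀ n, ‖f n‖ ≤ C) {Ξ : Lp ℝ 2 (cellMeasure ω)}
    (hΞ : ∀ y, Tendsto (fun n => inner ℝ (memLp_unfolding (hε_pos n) (f n)).toLp y) atTop
      (𝓝 (inner ℝ Ξ y)))
    {ψ χ : Space d → ℝ} (hψ : ψ ∈ testFunctions ω) (hχ : χ ∈ periodicTestFunctions d)
    (l m : Fin d) :
    Tendsto (fun n => ε n ^ 2 * ∫ x in ω, f n x *
        partialDeriv l (partialDeriv m fun x => ψ x * χ ((ε n)⁻¹ • x)) x) atTop
      (𝓝 (∫ p, Ξ p * (ψ p.1 * partialDeriv l (partialDeriv m χ) p.2) ∂(cellMeasure ω))) := by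
  have lim : ∀ {ψ χ : Space d → ℝ}, ψ ∈ testFunctions ω → χ ∈ periodicTestFunctions d →
      Tendsto (fun n => ∫ x in ω, f n x * (ψ x * χ ((ε n)⁻¹ • x))) atTop
      (𝓝 (∫ p, Ξ p * (ψ p.1 * χ p.2) ∂(cellMeasure ω))) := fun hψ hχ =>
    tendsto_integral_oscillating hω hε_pos hε hf hΞ hψ.1.continuous hψ.2.1 hψ.2.2
      hχ.1.continuous hχ.2
  have hψl := partialDeriv_mem_testFunctions hψ l
  have hψm := partialDeriv_mem_testFunctions hψ m
  have hψlm := partialDeriv_mem_testFunctions hψm l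
  have hχl := partialDeriv_mem_periodicTestFunctions hχ l
  have hχm := partialDeriv_mem_periodicTestFunctions hχ m
  have hχlm := partialDeriv_mem_periodicTestFunctions hχm l
  have h1 := (hε.pow 2).mul (lim hψlm hχ)
  have h2 := hε.mul (lim hψm hχl)
  have h3 := hε.mul (lim hψl hχm)
  have h4 := ((h1.add h2).add h3).add (lim hψ hχlm)
  simp only [ne_eq, OfNat.ofNat_ne_zero, not_false_eq_true, zero_pow, zero_mul, zero_add] at h4
  refine h4.congr fun n => ?_
  have hsm : ∀ {χ : Space d → ℝ}, ContDiff ℝ (⊤ : ℕ∞) χ →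
      ContDiff ℝ (⊤ : ℕ∞) fun x => χ ((ε n)⁻¹ • x) := fun h =>
    h.comp (contDiff_const_smul _)
  have hint : ∀ {ψ χ : Space d → ℝ}, ψ ∈ testFunctions ω → χ ∈ periodicTestFunctions d →
      Integrable (fun x => f n x * (ψ x * χ ((ε n)⁻¹ • x))) (volume.restrict ω) := fun hψ hχ =>
    integrable_mul_of_memLp (Lp.memLp _)
      (testFunctions_memLp ω _ (mul_mem_testFunctions hψ (hsm hχ.1))).1
  have hne := (hε_pos n).ne'
  have e : ∀ x, partialDeriv l (partialDeriv m fun x => ψ x * χ ((ε n)⁻¹ • x)) x =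
      partialDeriv l (partialDeriv m ψ) x * χ ((ε n)⁻¹ • x) +
      (ε n)⁻¹ * (partialDeriv m ψ x * partialDeriv l χ ((ε n)⁻¹ • x)) +
      (ε n)⁻¹ * (partialDeriv l ψ x * partialDeriv m χ ((ε n)⁻¹ • x)) +
      (ε n)⁻¹ ^ 2 * (ψ x * partialDeriv l (partialDeriv m χ) ((ε n)⁻¹ • x)) := by
    intro x
    rw [partialDeriv_mul hψ.1 (hsm hχ.1), partialDeriv_comp_smul χ,
      partialDeriv_add (hψm.1.mul (hsm hχ.1)) (hψ.1.mul (contDiff_const.mul (hsm hχm.1))),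
      partialDeriv_mul hψm.1 (hsm hχ.1), partialDeriv_mul hψ.1 (contDiff_const.mul (hsm hχm.1)),
      partialDeriv_const_mul (hsm hχm.1), partialDeriv_comp_smul χ,
      partialDeriv_comp_smul (partialDeriv m χ)]
    ring
  have e' : ∫ x in ω, f n x *
        partialDeriv l (partialDeriv m fun x => ψ x * χ ((ε n)⁻¹ • x)) x =
      ∫ x in ω, (f n x * (partialDeriv l (partialDeriv m ψ) x * χ ((ε n)⁻¹ • x)) +
        (ε n)⁻¹ * (f n x * (partialDeriv m ψ x * partialDeriv l χ ((ε n)⁻¹ • x))) +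
        (ε n)⁻¹ * (f n x * (partialDeriv l ψ x * partialDeriv m χ ((ε n)⁻¹ • x))) +
        (ε n)⁻¹ ^ 2 * (f n x * (ψ x * partialDeriv l (partialDeriv m χ) ((ε n)⁻¹ • x)))) := by
    refine integral_congr_ae (Eventually.of_forall fun x => ?_)
    simp only [e]
    ring
  rw [e', integral_add_three_const_mul (hint hψlm hχ) (hint hψm hχl) (hint hψl hχm)
    (hint hψ hχlm)]
  field_simp

/-- The two-scale limits of second derivatives satisfy the compatibility conditions of second
derivatives in the fast variable. -/
lemma ae_integral_twoScale_symm (hω : IsOpen ω) (hε_pos : ∀ n, 0 < ε n)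
    (hε : Tendsto ε atTop (𝓝 0)) {u : ℕ → H2 ω} {C : ℝ} (hu : ∀ n i j, ‖(u n).1.hess i j‖ ≤ C)
    {Ξ : Fin d → Fin d → Lp ℝ 2 (cellMeasure ω)}
    (hΞ : ∀ i j y, Tendsto (fun n => inner ℝ
      (memLp_unfolding (hε_pos n) ((u n).1.hess i j)).toLp y) atTop (𝓝 (inner ℝ (Ξ i j) y)))
    {χ : Space d → ℝ} (hχ : χ ∈ periodicTestFunctions d) (i j l m : Fin d) :
    ∀ᵐ x ∂(volume.restrict ω),
      ∫ y in unitCell d, Ξ i j (x, y) * partialDeriv l (partialDeriv m χ) y =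
        ∫ y in unitCell d, Ξ l m (x, y) * partialDeriv i (partialDeriv j χ) y := by
  have hc : ∀ a b : Fin d, Continuous (partialDeriv a (partialDeriv b χ)) := fun a b =>
    continuous_partialDeriv (contDiff_partialDeriv hχ.1 b) a
  refine ae_integral_cell_eq hω (hc l m)
    (integrable_cell_mul (Ξ := Ξ l m) hω (hc i j)).integral_prod_left fun ψ hψ => ?_
  have h1 := tendsto_integral_partialDeriv_oscillating hω hε_pos hε (fun n => hu n i j) (hΞ i j)
    hψ hχ l m
  have h2 := tendsto_integral_partialDeriv_oscillating hω hε_pos hε (fun n => hu n l m) (hΞ l m)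
    hψ hχ i j
  have h12 : ∫ p, Ξ i j p * (ψ p.1 * partialDeriv l (partialDeriv m χ) p.2) ∂(cellMeasure ω) =
      ∫ p, Ξ l m p * (ψ p.1 * partialDeriv i (partialDeriv j χ) p.2) ∂(cellMeasure ω) := by
    refine tendsto_nhds_unique (h1.congr fun n => ?_) h2
    congr 1
    exact integral_hess_symm (fun φ hφ => ⟨hφ.1, partialDeriv_mem_testFunctions hφ⟩) (u n).2
      (mul_mem_testFunctions hψ (hχ.1.comp (contDiff_const_smul _))) i j l m
  rw [h12]
  have hprod : Integrable (fun p => Ξ l m p * (ψ p.1 * partialDeriv i (partialDeriv j χ) p.2))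
      ((volume.restrict ω).prod (volume.restrict (unitCell d))) :=
    integrable_mul_of_memLp (Lp.memLp _) (memLp_mul_cell hω hψ.1.continuous hψ.2.1 (hc i j))
  refine (integral_prod _ hprod).trans ?_
  refine integral_congr_ae (Eventually.of_forall fun x => ?_)
  simp only
  rw [← integral_mul_const]
  refine integral_congr_ae (Eventually.of_forall fun y => ?_)
  simp only
  ring

/-- The cell average of a weak two-scale limit is the weak limit. -/
lemma ae_integral_twoScale_eq (hω : IsOpen ω) (hε_pos : ∀ n, 0 < ε n)
    (hε : Tendsto ε atTop (𝓝 0)) {f : ℕ → Lp ℝ 2 (volume.restrict ω)} {C : ℝ}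
    (hf : ∀ n, ‖f n‖ ≤ C) {Ξ : Lp ℝ 2 (cellMeasure ω)}
    (hΞ : ∀ y, Tendsto (fun n => inner ℝ (memLp_unfolding (hε_pos n) (f n)).toLp y) atTop
      (𝓝 (inner ℝ Ξ y)))
    {f₀ : Lp ℝ 2 (volume.restrict ω)}
    (hf₀ : ∀ y, Tendsto (fun n => inner ℝ (f n) y) atTop (𝓝 (inner ℝ f₀ y))) :
    ∀ᵐ x ∂(volume.restrict ω), ∫ y in unitCell d, Ξ (x, y) = f₀ x := by
  have := ae_integral_cell_eq (Ξ := Ξ) (χ := fun _ => 1) (G := f₀) hω continuous_const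
    ((Lp.memLp f₀).integrable (by norm_num)) fun ψ hψ => by
      refine tendsto_nhds_unique (tendsto_integral_oscillating hω hε_pos hε hf hΞ
        hψ.1.continuous hψ.2.1 hψ.2.2 continuous_const fun _ _ => rfl) ?_
      have h := hf₀ (testFunctions_memLp ω ψ hψ).1.toLp
      simp_rw [inner_toLp] at h
      simpa only [mul_one] using h
  simpa only [mul_one] using this

end Compatibility

section Torus

attribute [local instance] instMeasureSpaceUnitAddCircle
  instIsAddHaarMeasureUnitAddCircleVolume instIsProbabilityMeasureUnitAddCircleVolume

/-- The half-open box `(0,1]^d`. -/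
def upperBox (d : ℕ) : Set (Fin d → ℝ) := {x | ∀ i, x i ∈ Set.Ioc ((0 : Fin d → ℝ) i)
  ((0 : Fin d → ℝ) i + 1)}

lemma measurableSet_upperBox (d : ℕ) : MeasurableSet (upperBox d) :=
  MeasurableSet.univ_pi' fun _ => measurableSet_Ioc

lemma toLp_preimage_unitCell_ae_eq (d : ℕ) :
    (WithLp.toLp 2 ⁻¹' unitCell d : Set (Fin d → ℝ)) =ᵐ[volume] Set.Icc (0 : Fin d → ℝ) 1 := by
  have e : (WithLp.toLp 2 ⁻¹' unitCell d : Set (Fin d → ℝ)) =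
      Set.univ.pi fun _ => Set.Ico (0 : ℝ) 1 := by
    ext x; simp [unitCell]
  rw [e]
  exact Measure.univ_pi_Ico_ae_eq_Icc (μ := fun _ : Fin d => (volume : Measure ℝ))
    (f := fun _ => 0) (g := fun _ => 1)

lemma measurePreserving_toLp_unitCell (d : ℕ) :
    MeasurePreserving (WithLp.toLp 2) (volume.restrict (Set.Icc (0 : Fin d → ℝ) 1))
      (volume.restrict (unitCell d)) := by
  rw [← Measure.restrict_congr_set (toLp_preimage_unitCell_ae_eq d)]
  exact (PiLp.volume_preserving_toLp (Fin d)).restrict_preimage (measurableSet_unitCell d)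

lemma map_toLp_restrict_upperBox (d : ℕ) :
    (volume.restrict (upperBox d)).map (WithLp.toLp 2) = volume.restrict (unitCell d) := by
  rw [← (measurePreserving_toLp_unitCell d).map_eq]
  congr 1
  refine Measure.restrict_congr_set ?_
  have e : upperBox d = Set.univ.pi fun _ => Set.Ioc (0 : ℝ) 1 := by
    ext x; simp [upperBox]
  rw [e]
  exact Measure.univ_pi_Ioc_ae_eq_Icc (μ := fun _ : Fin d => (volume : Measure ℝ))
    (f := fun _ => 0) (g := fun _ => 1)

/-- The section of the projection onto the torus with values in `(0,1]^d`. -/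
def torusSection {d : ℕ} (t : UnitAddTorus (Fin d)) : Space d :=
  WithLp.toLp 2 fun i => (AddCircle.equivIoc (1 : ℝ) 0 (t i) : ℝ)

lemma measurable_torusSection (d : ℕ) :
    Measurable (torusSection : UnitAddTorus (Fin d) → Space d) := by
  refine (PiLp.volume_preserving_toLp (Fin d)).measurable.comp (measurable_pi_lambda _ fun i => ?_)
  exact measurable_subtype_coe.comp
    ((AddCircle.measurableEquivIoc 1 0).measurable.comp (measurable_pi_apply i))

lemma torusSection_coe {d : ℕ} {x : Fin d → ℝ} (hx : x ∈ upperBox d) :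
    torusSection (fun i => (x i : UnitAddCircle)) = WithLp.toLp 2 x := by
  ext i
  exact AddCircle.equivIoc_coe_of_mem (hx i)

lemma measurePreserving_torusSection (d : ℕ) :
    MeasurePreserving (torusSection : UnitAddTorus (Fin d) → Space d) volume
      (volume.restrict (unitCell d)) := by
  refine ⟨measurable_torusSection d, Measure.ext fun s hs => ?_⟩
  rw [← map_toLp_restrict_upperBox, ← lintegral_indicator_one hs, ← lintegral_indicator_one hs,
    lintegral_map (measurable_one.indicator hs) (measurable_torusSection d),
    lintegral_map (measurable_one.indicator hs)
      (PiLp.volume_preserving_toLp (Fin d)).measurable, UnitAddTorus.lintegral_preimage _ 0]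
  refine setLIntegral_congr_fun (measurableSet_upperBox d) fun x hx => ?_
  rw [torusSection_coe hx]

lemma integral_comp_torusSection {d : ℕ} {E : Type*} [NormedAddCommGroup E] [NormedSpace ℝ E]
    {G : Space d → E} (hG : AEStronglyMeasurable G (volume.restrict (unitCell d))) :
    ∫ t, G (torusSection t) = ∫ y in unitCell d, G y := by
  have hσ := measurePreserving_torusSection d
  rw [← hσ.map_eq, integral_map hσ.measurable.aemeasurable (by rwa [hσ.map_eq])]

/-- The phase `2π k·y`. -/
def phase {d : ℕ} (k : Fin d → ℤ) (y : Space d) : ℝ := 2 * Real.pi * ∑ i, k i * y i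

lemma mFourier_eq_exp {d : ℕ} (k : Fin d → ℤ) (t : UnitAddTorus (Fin d)) :
    UnitAddTorus.mFourier k t = Complex.exp (phase k (torusSection t) * Complex.I) := by
  have h : ∀ i, fourier (k i) (t i) =
      Complex.exp (2 * Real.pi * Complex.I * k i * (torusSection t i : ℝ)) := by
    intro i
    have ht : t i = ((torusSection t i : ℝ) : UnitAddCircle) :=
      (AddCircle.coe_equivIoc (p := (1 : ℝ)) (a := 0) (y := t i)).symm
    conv_lhs => rw [ht]
    rw [fourier_coe_apply]
    simp
  change ∏ i, fourier (k i) (t i) = _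
  simp_rw [h]
  rw [← Complex.exp_sum]
  congr 1
  rw [phase]
  push_cast
  rw [Finset.mul_sum, Finset.sum_mul]
  exact Finset.sum_congr rfl fun i _ => by ring

/-- Parseval's identity on the unit cell, in real form. -/
lemma hasSum_sq_fourier {d : ℕ} (u : Lp ℝ 2 (volume.restrict (unitCell d))) :
    HasSum (fun k : Fin d → ℤ =>
      (∫ y in unitCell d, u y * Real.cos (phase k y)) ^ 2 +
        (∫ y in unitCell d, u y * Real.sin (phase k y)) ^ 2) (‖u‖ ^ 2) := by
  have hσ := measurePreserving_torusSection d
  have hu : MemLp (fun t => ((u (torusSection t) : ℝ) : ℂ)) 2 volume :=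
    ((Lp.memLp u).comp_measurePreserving hσ).ofReal
  have key := UnitAddTorus.hasSum_sq_mFourierCoeff hu.toLp
  have e1 : ∫ t, ‖(hu.toLp : UnitAddTorus (Fin d) → ℂ) t‖ ^ 2 = ‖u‖ ^ 2 := by
    rw [norm_sq_eq_integral, ← integral_comp_torusSection (G := fun y => u y ^ 2)
      ((Lp.stronglyMeasurable u).aestronglyMeasurable.pow 2)]
    refine integral_congr_ae ?_
    filter_upwards [hu.coeFn_toLp] with t ht
    rw [ht]
    simp
  have hui : Integrable u (volume.restrict (unitCell d)) := (Lp.memLp u).integrable (by norm_num)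
  have hphase : ∀ k : Fin d → ℤ, Continuous (phase k : Space d → ℝ) := fun k => by
    unfold phase; fun_prop
  have e2 : ∀ k, ‖UnitAddTorus.mFourierCoeff (hu.toLp : UnitAddTorus (Fin d) → ℂ) k‖ ^ 2 =
      (∫ y in unitCell d, u y * Real.cos (phase k y)) ^ 2 +
        (∫ y in unitCell d, u y * Real.sin (phase k y)) ^ 2 := by
    intro k
    have hcos : Integrable (fun y => u y * Real.cos (phase k y)) (volume.restrict (unitCell d)) :=
      hui.mul_bdd (c := 1) (Real.continuous_cos.comp (hphase k)).aestronglyMeasurable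
        (Eventually.of_forall fun y => Real.abs_cos_le_one _)
    have hsin : Integrable (fun y => u y * Real.sin (phase k y)) (volume.restrict (unitCell d)) :=
      hui.mul_bdd (c := 1) (Real.continuous_sin.comp (hphase k)).aestronglyMeasurable
        (Eventually.of_forall fun y => Real.abs_sin_le_one _)
    have e3 : UnitAddTorus.mFourierCoeff (hu.toLp : UnitAddTorus (Fin d) → ℂ) k =
        ∫ y in unitCell d, (((u y * Real.cos (phase k y) : ℝ) : ℂ) -
          ((u y * Real.sin (phase k y) : ℝ) : ℂ) * Complex.I) := by
      rw [← integral_comp_torusSection (hcos.ofReal.aestronglyMeasurable.sub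
        (hsin.ofReal.aestronglyMeasurable.mul_const _))]
      refine integral_congr_ae ?_
      filter_upwards [hu.coeFn_toLp] with t ht
      simp only [ht]
      rw [UnitAddTorus.mFourier_neg, mFourier_eq_exp, Complex.exp_mul_I, ← Complex.ofReal_cos,
        ← Complex.ofReal_sin]
      simp only [map_add, map_mul, Complex.conj_ofReal, Complex.conj_I, smul_eq_mul,
        Complex.ofReal_mul]
      ring
    have ec := integral_ofReal (𝕜 := ℂ) (μ := volume.restrict (unitCell d))
      (f := fun y => u y * Real.cos (phase k y))
    have es := integral_ofReal (𝕜 := ℂ) (μ := volume.restrict (unitCell d))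
      (f := fun y => u y * Real.sin (phase k y))
    simp only [Complex.coe_algebraMap] at ec es
    rw [e3, integral_sub hcos.ofReal (hsin.ofReal.mul_const _), integral_mul_const,
      ec, es, ← Complex.normSq_eq_norm_sq, Complex.normSq_apply]
    simp [sq]
  rw [e1] at key
  simpa only [e2] using key

end Torus

/-- The integral of a partial derivative of a periodic function over the unit cell vanishes. -/
lemma integral_partialDeriv_unitCell {d : ℕ} {f : Space d → ℝ} (hf : f ∈ periodicTestFunctions d)
    (i : Fin d) : ∫ y in unitCell d, partialDeriv i f y = 0 := by
  obtain ⟨n, rfl⟩ : ∃ n, d = n + 1 := ⟨d - 1, by have := i.2; omega⟩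
  have hd : Differentiable ℝ f := hf.1.differentiable (by simp)
  let e : (Fin (n + 1) → ℝ) ≃L[ℝ] Space (n + 1) := (EuclideanSpace.equiv (Fin (n + 1)) ℝ).symm
  have he : ∀ x, e x = WithLp.toLp 2 x := fun x => rfl
  have hc : Continuous fun x : Fin (n + 1) → ℝ => partialDeriv i f (e x) :=
    (continuous_partialDeriv hf.1 i).comp e.continuous
  let F : (Fin (n + 1) → ℝ) → Fin (n + 1) → ℝ := fun x => Pi.single i (f (e x))
  let F' : (Fin (n + 1) → ℝ) → (Fin (n + 1) → ℝ) →L[ℝ] (Fin (n + 1) → ℝ) := fun x =>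
    (ContinuousLinearMap.single ℝ (fun _ : Fin (n + 1) => ℝ) i).comp
      ((fderiv ℝ f (e x)).comp (e : (Fin (n + 1) → ℝ) →L[ℝ] Space (n + 1)))
  have hF : ∀ x, HasFDerivAt F (F' x) x := fun x =>
    (ContinuousLinearMap.single ℝ (fun _ : Fin (n + 1) => ℝ) i).hasFDerivAt.comp x
      ((hd (e x)).hasFDerivAt.comp x e.hasFDerivAt)
  have hdiv : ∀ x, ∑ j, F' x (Pi.single j 1) j = partialDeriv i f (e x) := by
    intro x
    rw [Finset.sum_eq_single i]
    · simp [F', partialDeriv, he]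
    · intro j _ hj
      simp [F', hj]
    · simp
  have h := integral_divergence_of_hasFDerivAt_off_countable (E := ℝ) (n := n) 0 1
    (by intro j; simp) F F' ∅ Set.countable_empty
    (fun x _ => (hF x).continuousAt.continuousWithinAt) (fun x _ => hF x)
    (by simp_rw [hdiv]; exact hc.continuousOn.integrableOn_compact isCompact_Icc)
  simp_rw [hdiv] at h
  have h0 : ∫ y in unitCell (n + 1), partialDeriv i f y =
      ∫ x in Set.Icc (0 : Fin (n + 1) → ℝ) 1, partialDeriv i f (e x) := by
    have hm := measurePreserving_toLp_unitCell (n + 1)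
    rw [← hm.map_eq, integral_map hm.measurable.aemeasurable
      (continuous_partialDeriv hf.1 i).aestronglyMeasurable]
    rfl
  rw [h0, h]
  refine Finset.sum_eq_zero fun j _ => ?_
  rw [sub_eq_zero]
  refine integral_congr_ae (Eventually.of_forall fun x => ?_)
  simp only [F]
  rcases eq_or_ne j i with rfl | hj
  · simp only [Pi.single_eq_same]
    have : e (j.insertNth (1 : ℝ) x) = e (j.insertNth (0 : ℝ) x) + EuclideanSpace.single j 1 := by
      ext a
      rw [he, he]
      rcases Fin.eq_self_or_eq_succAbove j a with rfl | ⟨b, rfl⟩ <;> simp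
    simpa using (congrArg f this).trans (hf.2 j _)
  · simp [hj]

section Trig

variable {d : ℕ}

/-- The real trigonometric functions on the torus. -/
def trig (k : Fin d → ℤ) (b : Bool) (y : Space d) : ℝ :=
  if b then Real.cos (phase k y) else Real.sin (phase k y)

/-- The phase as a linear map. -/
def phaseL (k : Fin d → ℤ) : Space d →L[ℝ] ℝ :=
  (2 * Real.pi) • ∑ i, (k i : ℝ) • EuclideanSpace.proj i

lemma phaseL_apply (k : Fin d → ℤ) (y : Space d) : phaseL k y = phase k y := by
  simp [phaseL, phase]

lemma phaseL_single (k : Fin d → ℤ) (i : Fin d) :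
    phaseL k (EuclideanSpace.single i 1) = 2 * Real.pi * k i := by
  simp [phaseL_apply, phase]

lemma trig_mem_periodicTestFunctions (k : Fin d → ℤ) (b : Bool) :
    trig k b ∈ periodicTestFunctions d := by
  have e : ∀ y, phase k y = phaseL k y := fun y => (phaseL_apply k y).symm
  refine ⟨?_, fun i x => ?_⟩
  · cases b
    · have : trig k false = fun y => Real.sin (phaseL k y) := by ext y; simp [trig, e]
      rw [this]
      exact Real.contDiff_sin.comp (phaseL k).contDiff
    · have : trig k true = fun y => Real.cos (phaseL k y) := by ext y; simp [trig, e]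
      rw [this]
      exact Real.contDiff_cos.comp (phaseL k).contDiff
  · simp only [trig, e, map_add, phaseL_single]
    have h : phaseL k x + 2 * Real.pi * k i = phaseL k x + k i * (2 * Real.pi) := by ring
    rw [h, Real.cos_add_int_mul_two_pi, Real.sin_add_int_mul_two_pi]

lemma partialDeriv_trig (k : Fin d → ℤ) (b : Bool) (i : Fin d) (y : Space d) :
    partialDeriv i (trig k b) y =
      (if b then -1 else 1) * (2 * Real.pi * k i) * trig k (!b) y := by
  have e : ∀ y, phase k y = phaseL k y := fun y => (phaseL_apply k y).symm
  have hd := (phaseL k).hasFDerivAt (x := y)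
  rw [partialDeriv]
  cases b
  · have : trig k false = fun y => Real.sin (phaseL k y) := by ext y; simp [trig, e]
    rw [this, hd.sin.fderiv]
    simp [trig, e, phaseL_single]
    ring
  · have : trig k true = fun y => Real.cos (phaseL k y) := by ext y; simp [trig, e]
    rw [this, hd.cos.fderiv]
    simp [trig, e, phaseL_single]
    ring

lemma partialDeriv_partialDeriv_trig (k : Fin d → ℤ) (b : Bool) (l m : Fin d) (y : Space d) :
    partialDeriv l (partialDeriv m (trig k b)) y =
      -(2 * Real.pi) ^ 2 * (k l * k m) * trig k b y := by
  have h : partialDeriv m (trig k b) = fun y =>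
      ((if b then -1 else 1) * (2 * Real.pi * k m)) * trig k (!b) y :=
    funext fun y => partialDeriv_trig k b m y
  rw [h, partialDeriv_const_mul (trig_mem_periodicTestFunctions k _).1]
  simp only [partialDeriv_trig]
  cases b <;> simp <;> ring

lemma const_mem_periodicTestFunctions (c : ℝ) : (fun _ : Space d => c) ∈ periodicTestFunctions d :=
  ⟨contDiff_const, fun _ _ => rfl⟩

/-- The measure on the unit cell. -/
abbrev cellVol (d : ℕ) : Measure (Space d) := volume.restrict (unitCell d)

lemma HasWeakPartial.integral_eq_zero {i : Fin d} {u g : Lp ℝ 2 (cellVol d)}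
    (h : HasWeakPartial (cellVol d) (periodicTestFunctions d) i u g) : ∫ y, g y ∂(cellVol d) = 0 := by
  have := h _ (const_mem_periodicTestFunctions 1)
  simpa [partialDeriv] using this

lemma HasWeakPartial.integral_trig {i : Fin d} {u g : Lp ℝ 2 (cellVol d)}
    (h : HasWeakPartial (cellVol d) (periodicTestFunctions d) i u g) (k : Fin d → ℤ) (b : Bool) :
    ∫ y, g y * trig k b y ∂(cellVol d) =
      (if b then 1 else -1) * (2 * Real.pi * k i) * ∫ y, u y * trig k (!b) y ∂(cellVol d) := by
  have h1 := h _ (trig_mem_periodicTestFunctions k b)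
  rw [← neg_eq_iff_eq_neg] at h1
  rw [← h1, ← integral_const_mul, ← integral_neg]
  refine integral_congr_ae (Eventually.of_forall fun y => ?_)
  simp only [partialDeriv_trig]
  cases b <;> simp <;> ring

lemma hasSum_sq_trig (u : Lp ℝ 2 (cellVol d)) :
    HasSum (fun k : Fin d → ℤ => (∫ y, u y * trig k true y ∂(cellVol d)) ^ 2 +
      (∫ y, u y * trig k false y ∂(cellVol d)) ^ 2) (‖u‖ ^ 2) := by
  simpa [trig] using hasSum_sq_fourier u

lemma eq_zero_of_integral_trig (u : Lp ℝ 2 (cellVol d))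
    (h : ∀ k b, ∫ y, u y * trig k b y ∂(cellVol d) = 0) : u = 0 := by
  have := hasSum_sq_trig u
  have hz : ∀ k : Fin d → ℤ, (∫ y, u y * trig k true y ∂(cellVol d)) ^ 2 +
      (∫ y, u y * trig k false y ∂(cellVol d)) ^ 2 = 0 := fun k => by rw [h, h]; norm_num
  rw [funext hz] at this
  simpa using this.unique hasSum_zero

lemma integral_trig_zero (u : Lp ℝ 2 (cellVol d)) (hu : ∫ y, u y ∂(cellVol d) = 0) (b : Bool) :
    ∫ y, u y * trig (0 : Fin d → ℤ) b y ∂(cellVol d) = 0 := by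
  cases b <;> simp [trig, phase, hu]

/-- The Poincaré inequality on the torus. -/
lemma norm_sq_le_sum_norm_sq_of_integral_eq_zero {u : Lp ℝ 2 (cellVol d)}
    {g : Fin d → Lp ℝ 2 (cellVol d)}
    (h : ∀ i, HasWeakPartial (cellVol d) (periodicTestFunctions d) i u (g i))
    (hu : ∫ y, u y ∂(cellVol d) = 0) : ‖u‖ ^ 2 ≤ ∑ i, ‖g i‖ ^ 2 := by
  refine hasSum_le (fun k => ?_) (hasSum_sq_trig u) (hasSum_sum fun i _ => hasSum_sq_trig (g i))
  rcases eq_or_ne k 0 with rfl | hk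
  · rw [integral_trig_zero u hu, integral_trig_zero u hu]
    simp only [ne_eq, OfNat.ofNat_ne_zero, not_false_eq_true, zero_pow, add_zero]
    positivity
  · obtain ⟨i, hi⟩ := Function.ne_iff.1 hk
    refine le_trans ?_ (Finset.single_le_sum (f := fun i =>
      (∫ y, g i y * trig k true y ∂(cellVol d)) ^ 2 +
      (∫ y, g i y * trig k false y ∂(cellVol d)) ^ 2) (fun i _ => by positivity)
      (Finset.mem_univ i))
    simp only [(h i).integral_trig, mul_pow, Bool.not_true, Bool.not_false]
    have h1 : (1 : ℝ) ≤ (k i : ℝ) ^ 2 := by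
      have : (1 : ℤ) ≤ k i ^ 2 := Int.add_one_le_iff.2 (sq_pos_of_ne_zero hi)
      exact_mod_cast this
    have h2 : (1 : ℝ) ≤ (2 * Real.pi) ^ 2 := by nlinarith [Real.pi_gt_three]
    have h3 : (1 : ℝ) ≤ 2 ^ 2 * Real.pi ^ 2 * (k i : ℝ) ^ 2 := by
      rw [← mul_pow]; nlinarith
    simp only [if_true, Bool.false_eq_true, if_false]
    nlinarith [sq_nonneg (∫ y, u y * trig k true y ∂(cellVol d)),
      sq_nonneg (∫ y, u y * trig k false y ∂(cellVol d)),
      mul_nonneg (sub_nonneg.2 h3) (sq_nonneg (∫ y, u y * trig k true y ∂(cellVol d))),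
      mul_nonneg (sub_nonneg.2 h3) (sq_nonneg (∫ y, u y * trig k false y ∂(cellVol d)))]

end Trig

section Jets

variable {d : ℕ}

lemma hasWeakPartial_toLp {χ : Space d → ℝ} (hχ : χ ∈ periodicTestFunctions d) (i : Fin d) :
    HasWeakPartial (cellVol d) (periodicTestFunctions d) i
      (periodicTestFunctions_memLp d χ hχ).1.toLp
      ((periodicTestFunctions_memLp d χ hχ).2 i).toLp := by
  intro φ hφ
  have hm := periodicTestFunctions_memLp d χ hχ
  have hmφ := periodicTestFunctions_memLp d φ hφ
  have e1 : ∫ y, (hm.1.toLp : Space d → ℝ) y * partialDeriv i φ y ∂(cellVol d) =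
      ∫ y, χ y * partialDeriv i φ y ∂(cellVol d) := by
    refine integral_congr_ae ?_
    filter_upwards [hm.1.coeFn_toLp] with y hy
    rw [hy]
  have e2 : ∫ y, ((hm.2 i).toLp : Space d → ℝ) y * φ y ∂(cellVol d) =
      ∫ y, partialDeriv i χ y * φ y ∂(cellVol d) := by
    refine integral_congr_ae ?_
    filter_upwards [(hm.2 i).coeFn_toLp] with y hy
    rw [hy]
  rw [e1, e2, eq_neg_iff_add_eq_zero, add_comm,
    ← integral_add (integrable_mul_of_memLp (hm.2 i) hmφ.1) (integrable_mul_of_memLp hm.1 (hmφ.2 i)),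
    ← integral_partialDeriv_unitCell (f := fun y => χ y * φ y) ⟨hχ.1.mul hφ.1, fun j x => by
      simp only [hχ.2 j x, hφ.2 j x]⟩ i, partialDeriv_mul hχ.1 hφ.1]

/-- The jet of a smooth periodic function. -/
def periodicJet {χ : Space d → ℝ} (hχ : χ ∈ periodicTestFunctions d) : Jet (cellVol d) :=
  WithLp.toLp 2 fun ι => match ι with
    | Sum.inl _ => (periodicTestFunctions_memLp d χ hχ).1.toLp
    | Sum.inr (Sum.inl i) => ((periodicTestFunctions_memLp d χ hχ).2 i).toLp
    | Sum.inr (Sum.inr (i, j)) => ((periodicTestFunctions_memLp d _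
        (partialDeriv_mem_periodicTestFunctions hχ i)).2 j).toLp

lemma periodicJet_mem {χ : Space d → ℝ} (hχ : χ ∈ periodicTestFunctions d) :
    periodicJet hχ ∈ H2per d :=
  ⟨fun i => hasWeakPartial_toLp hχ i,
    fun i j => hasWeakPartial_toLp (partialDeriv_mem_periodicTestFunctions hχ i) j⟩

lemma Jet.norm_sq {μ : Measure (Space d)} (J : Jet μ) : ‖J‖ ^ 2 =
    ‖J.val‖ ^ 2 + (∑ i, ‖J.grad i‖ ^ 2 + ∑ i, ∑ j, ‖J.hess i j‖ ^ 2) := by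
  rw [PiLp.norm_sq_eq_of_L2 (fun _ : JetIndex d => Lp ℝ 2 μ) J, Fintype.sum_sum_type,
    Fintype.sum_sum_type, Fintype.sum_prod_type]
  simp only [Finset.univ_unique, Finset.sum_singleton]
  rfl

/-- Matrix fields on the unit cell. -/
abbrev CellMatrix (d : ℕ) : Type := PiLp 2 (fun _ : Fin d × Fin d => Lp ℝ 2 (cellVol d))

instance completeSpace_H2per : CompleteSpace (H2per d) :=
  (isClosed_weakH2 (periodicTestFunctions_memLp d)).completeSpace_coe

/-- The mean value of a periodic function as a functional on `H²_per`. -/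
def meanL (d : ℕ) : H2per d →L[ℝ] ℝ :=
  (innerSL ℝ (periodicTestFunctions_memLp d _ (const_mem_periodicTestFunctions 1)).1.toLp).comp
    ((PiLp.proj 2 (fun _ : JetIndex d => Lp ℝ 2 (cellVol d)) (Sum.inl ())).comp (H2per d).subtypeL)

lemma meanL_apply (J : H2per d) : meanL d J = ∫ y, J.1.val y ∂(cellVol d) := by
  have : meanL d J = inner ℝ
      (periodicTestFunctions_memLp d _ (const_mem_periodicTestFunctions 1)).1.toLp J.1.val := rfl
  rw [this, real_inner_comm, inner_toLp]
  simp

/-- The second derivative as an operator on the periodic functions. -/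
def hessL (d : ℕ) : H2per d →L[ℝ] CellMatrix d :=
  ((PiLp.continuousLinearEquiv 2 ℝ (fun _ : Fin d × Fin d => Lp ℝ 2 (cellVol d))).symm :
    _ →L[ℝ] CellMatrix d).comp (ContinuousLinearMap.pi fun p =>
      (PiLp.proj 2 (fun _ : JetIndex d => Lp ℝ 2 (cellVol d)) (Sum.inr (Sum.inr p))).comp
        (H2per d).subtypeL)

lemma norm_sq_le_hessL (J : H2per d) (h0 : meanL d J = 0) : ‖J‖ ^ 2 ≤ 3 * ‖hessL d J‖ ^ 2 := by
  rw [meanL_apply] at h0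
  have h1 := norm_sq_le_sum_norm_sq_of_integral_eq_zero J.2.1 h0
  have h2 : ∀ i, ‖J.1.grad i‖ ^ 2 ≤ ∑ j, ‖J.1.hess i j‖ ^ 2 := fun i =>
    norm_sq_le_sum_norm_sq_of_integral_eq_zero (J.2.2 i) (J.2.1 i).integral_eq_zero
  have h3 : ‖hessL d J‖ ^ 2 = ∑ i, ∑ j, ‖J.1.hess i j‖ ^ 2 := by
    rw [PiLp.norm_sq_eq_of_L2 (fun _ : Fin d × Fin d => Lp ℝ 2 (cellVol d)) (hessL d J),
      Fintype.sum_prod_type]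
    rfl
  have h4 : ‖J‖ ^ 2 = _ := Jet.norm_sq J.1
  have h5 := Finset.sum_le_sum fun i (_ : i ∈ Finset.univ) => h2 i
  rw [h4, h3]
  linarith

lemma le_two_mul_of_sq_le {a b : ℝ} (hb : 0 ≤ b) (h : a ^ 2 ≤ 3 * b ^ 2) : a ≤ 2 * b :=
  abs_le_of_sq_le_sq' (by nlinarith [sq_nonneg b]) (by positivity) |>.2

/-- Least squares on the kernel of `m`: an operator that is bounded below there has a continuous
left inverse with residuals orthogonal to its range. -/
lemma exists_orthogonal_leftInverse {E F : Type*} [NormedAddCommGroup E] [NormedSpace ℝ E]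
    [CompleteSpace E] [NormedAddCommGroup F] [InnerProductSpace ℝ F] [CompleteSpace F]
    (m : E →L[ℝ] ℝ) (H : E →L[ℝ] F) (hH : ∀ x, m x = 0 → ‖x‖ ≤ 2 * ‖H x‖) :
    ∃ Q : F →L[ℝ] E, (∀ M, m (Q M) = 0) ∧
      ∀ M x, m x = 0 → inner ℝ (M - H (Q M)) (H x) = 0 := by
  let S : Submodule ℝ E := LinearMap.ker (m : E →ₗ[ℝ] ℝ)
  have hS : CompleteSpace S := m.isClosed_ker.completeSpace_coe
  let L : S →L[ℝ] F := H.comp S.subtypeL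
  have hL : AntilipschitzWith 2 L :=
    AddMonoidHomClass.antilipschitz_of_bound _ fun x => hH x.1 x.2
  have hclo : IsClosed (Set.range L) := hL.isClosed_range L.uniformContinuous
  let R : Submodule ℝ F := LinearMap.range (L : S →ₗ[ℝ] F)
  have hR : IsClosed (R : Set F) := by
    have : (R : Set F) = Set.range L := rfl
    rwa [this]
  have hRc : CompleteSpace R := hR.completeSpace_coe
  let e : S ≃L[ℝ] R := L.equivRange hL.injective hclo
  refine ⟨S.subtypeL.comp ((e.symm : R →L[ℝ] S).comp R.orthogonalProjectionOnto), fun M =>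
    (e.symm (R.orthogonalProjectionOnto M)).2, fun M x hx => ?_⟩
  have h : L (e.symm (R.orthogonalProjectionOnto M)) = R.starProjection M :=
    congrArg Subtype.val (e.apply_symm_apply (R.orthogonalProjectionOnto M))
  change inner ℝ (M - L (e.symm (R.orthogonalProjectionOnto M))) (L ⟨x, hx⟩) = 0
  rw [h]
  exact Submodule.starProjection_inner_eq_zero M _ ⟨⟨x, hx⟩, rfl⟩

lemma eq_zero_of_fourier (N : CellMatrix d) (hmean : ∀ p, ∫ y, N p y ∂(cellVol d) = 0)
    (hcompat : ∀ (k : Fin d → ℤ) b i j l m,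
      (k l * k m : ℝ) * ∫ y, N (i, j) y * trig k b y ∂(cellVol d) =
        (k i * k j) * ∫ y, N (l, m) y * trig k b y ∂(cellVol d))
    (horth : ∀ (k : Fin d → ℤ) b, k ≠ 0 →
      ∑ i, ∑ j, (k i * k j : ℝ) * ∫ y, N (i, j) y * trig k b y ∂(cellVol d) = 0)
    (i j : Fin d) : N (i, j) = 0 := by
  refine eq_zero_of_integral_trig _ fun k b => ?_
  rcases eq_or_ne k 0 with rfl | hk
  · exact integral_trig_zero _ (hmean _) b
  have h2 : (∑ l, ∑ m, (k l * k m : ℝ) * (k l * k m)) *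
      ∫ y, N (i, j) y * trig k b y ∂(cellVol d) = 0 := by
    have : (k i * k j : ℝ) *
        ∑ l, ∑ m, (k l * k m : ℝ) * ∫ y, N (l, m) y * trig k b y ∂(cellVol d) = 0 := by
      rw [horth k b hk, mul_zero]
    rw [← this, Finset.sum_mul, Finset.mul_sum]
    refine Finset.sum_congr rfl fun l _ => ?_
    rw [Finset.sum_mul, Finset.mul_sum]
    refine Finset.sum_congr rfl fun m _ => ?_
    rw [mul_assoc, hcompat k b i j l m]
    ring
  refine (mul_eq_zero.1 h2).resolve_left (ne_of_gt ?_)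
  obtain ⟨a, ha⟩ := Function.ne_iff.1 hk
  have ha' : (k a : ℝ) ≠ 0 := by exact_mod_cast ha
  refine Finset.sum_pos' (fun l _ => Finset.sum_nonneg fun m _ => mul_self_nonneg _)
    ⟨a, Finset.mem_univ a, ?_⟩
  refine Finset.sum_pos' (fun m _ => mul_self_nonneg _) ⟨a, Finset.mem_univ a, ?_⟩
  exact mul_self_pos.2 (mul_ne_zero ha' ha')

lemma integral_trig_eq_zero {k : Fin d → ℤ} (hk : k ≠ 0) (b : Bool) :
    ∫ y, trig k b y ∂(cellVol d) = 0 := by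
  obtain ⟨a, ha⟩ := Function.ne_iff.1 hk
  have e2 := integral_partialDeriv_unitCell (trig_mem_periodicTestFunctions k (!b)) a
  simp only [partialDeriv_trig, Bool.not_not] at e2
  rw [integral_const_mul] at e2
  refine (mul_eq_zero.1 e2).resolve_left ?_
  have : (k a : ℝ) ≠ 0 := by exact_mod_cast ha
  cases b <;> simp [this, Real.pi_ne_zero]

/-- The function `trig k b` as an element of `H²_per`. -/
def trigJet (k : Fin d → ℤ) (b : Bool) : H2per d :=
  ⟨_, periodicJet_mem (trig_mem_periodicTestFunctions k b)⟩

lemma meanL_trigJet {k : Fin d → ℤ} (hk : k ≠ 0) (b : Bool) : meanL d (trigJet k b) = 0 := by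
  rw [meanL_apply, ← integral_trig_eq_zero hk b]
  exact integral_congr_ae
    (periodicTestFunctions_memLp d _ (trig_mem_periodicTestFunctions k b)).1.coeFn_toLp

lemma inner_hessL_trigJet (N : CellMatrix d) (k : Fin d → ℤ) (b : Bool) :
    inner ℝ N (hessL d (trigJet k b)) = -(2 * Real.pi) ^ 2 *
      ∑ i, ∑ j, (k i * k j : ℝ) * ∫ y, N (i, j) y * trig k b y ∂(cellVol d) := by
  have hχ := trig_mem_periodicTestFunctions k b
  have e : ∀ i j, inner ℝ (N (i, j)) (hessL d (trigJet k b) (i, j)) =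
      -(2 * Real.pi) ^ 2 * ((k i * k j : ℝ) * ∫ y, N (i, j) y * trig k b y ∂(cellVol d)) := by
    intro i j
    refine (inner_toLp (N (i, j)) ((periodicTestFunctions_memLp d _
      (partialDeriv_mem_periodicTestFunctions hχ i)).2 j)).trans ?_
    simp only [partialDeriv_partialDeriv_trig, mul_left_comm _ (_ * (_ * _) : ℝ)]
    rw [integral_const_mul]
    ring
  rw [PiLp.inner_apply, Fintype.sum_prod_type]
  simp only [e, ← Finset.mul_sum]

lemma integral_hess_residual (M : CellMatrix d) (J : H2per d) (p : Fin d × Fin d)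
    {χ : Space d → ℝ} (hχ : χ ∈ periodicTestFunctions d) :
    ∫ y, (M - hessL d J) p y * χ y ∂(cellVol d) =
      ∫ y, M p y * χ y ∂(cellVol d) - ∫ y, J.1.hess p.1 p.2 y * χ y ∂(cellVol d) := by
  have hm := (periodicTestFunctions_memLp d χ hχ).1
  rw [← inner_toLp _ hm, ← inner_toLp _ hm, ← inner_toLp _ hm, ← inner_sub_left]
  rfl

lemma integral_residual_compat (M : CellMatrix d) (J : H2per d) (k : Fin d → ℤ) (b : Bool)
    (i j l m : Fin d)
    (h : ∫ y, M (i, j) y * partialDeriv l (partialDeriv m (trig k b)) y ∂(cellVol d) =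
      ∫ y, M (l, m) y * partialDeriv i (partialDeriv j (trig k b)) y ∂(cellVol d)) :
    (k l * k m : ℝ) * ∫ y, (M - hessL d J) (i, j) y * trig k b y ∂(cellVol d) =
      (k i * k j) * ∫ y, (M - hessL d J) (l, m) y * trig k b y ∂(cellVol d) := by
  have hpi : (2 * Real.pi) ^ 2 ≠ 0 := by positivity
  have hper : ∀ a c, partialDeriv a (partialDeriv c (trig k b)) ∈ periodicTestFunctions d :=
    fun a c => partialDeriv_mem_periodicTestFunctions
      (partialDeriv_mem_periodicTestFunctions (trig_mem_periodicTestFunctions k b) c) a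
  have e1 := integral_hess_residual M J (i, j) (hper l m)
  have e2 := integral_hess_residual M J (l, m) (hper i j)
  have e3 := integral_hess_symm (hT := periodicTestFunctions_memLp d)
    (fun φ hφ => ⟨hφ.1, partialDeriv_mem_periodicTestFunctions hφ⟩) J.2
    (trig_mem_periodicTestFunctions k b) i j l m
  simp only at e1 e2
  rw [h, e3, ← e2] at e1
  simp only [partialDeriv_partialDeriv_trig, mul_left_comm _ (_ * (_ * _) : ℝ)] at e1
  rw [integral_const_mul, integral_const_mul, mul_assoc (-_), mul_assoc (-_)] at e1
  exact mul_left_cancel₀ (neg_ne_zero.2 hpi) e1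

/-- A periodic matrix field of mean value zero that satisfies the compatibility conditions of
second derivatives is the second derivative of a periodic function, which depends continuously
on the field. -/
lemma exists_hessian_inverse (d : ℕ) : ∃ P : CellMatrix d →L[ℝ] H2per d,
    (∀ M, ∫ y, (P M).1.val y ∂(cellVol d) = 0) ∧
    ∀ M : CellMatrix d, (∀ p, ∫ y, M p y ∂(cellVol d) = 0) →
      (∀ k b i j l m,
        ∫ y, M (i, j) y * partialDeriv l (partialDeriv m (trig k b)) y ∂(cellVol d) =
        ∫ y, M (l, m) y * partialDeriv i (partialDeriv j (trig k b)) y ∂(cellVol d)) →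
      ∀ i j, (P M).1.hess i j = M (i, j) := by
  obtain ⟨P, hP, hPorth⟩ := exists_orthogonal_leftInverse (meanL d) (hessL d) fun J hJ =>
    le_two_mul_of_sq_le (norm_nonneg _) (norm_sq_le_hessL J hJ)
  refine ⟨P, fun M => by rw [← meanL_apply, hP], fun M hM hcompat i j => ?_⟩
  have hN : (M - hessL d (P M)) (i, j) = 0 := by
    refine eq_zero_of_fourier _ (fun p => ?_)
      (fun k b i j l m => integral_residual_compat M (P M) k b i j l m (hcompat k b i j l m))
      (fun k b hk => ?_) i j
    · have := integral_hess_residual M (P M) p (const_mem_periodicTestFunctions 1)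
      simp only [mul_one] at this
      rw [this, hM, ((P M).2.2 p.1 p.2).integral_eq_zero, sub_zero]
    · have := hPorth M _ (meanL_trigJet hk b)
      rw [inner_hessL_trigJet] at this
      exact (mul_eq_zero.1 this).resolve_left (neg_ne_zero.2 (by positivity))
  exact (sub_eq_zero.1 hN).symm

end Jets

section Limits

/-- Bounded sequences of tuples have a componentwise weakly convergent subsequence. -/
lemma exists_componentwise_weak_limit {ι E : Type*} [Fintype ι] [NormedAddCommGroup E]
    [InnerProductSpace ℝ E] [CompleteSpace E] (x : ℕ → PiLp 2 (fun _ : ι => E)) (C : ℝ)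
    (hx : ∀ n, ‖x n‖ ≤ C) : ∃ σ : ℕ → ℕ, StrictMono σ ∧ ∃ a : PiLp 2 (fun _ : ι => E), ∀ p y,
      Tendsto (fun n => inner ℝ (x (σ n) p) y) atTop (𝓝 (inner ℝ (a p) y)) := by
  classical
  obtain ⟨σ, hσ, a, ha⟩ := exists_weakly_convergent_subseq x C hx
  refine ⟨σ, hσ, a, fun p y => ?_⟩
  have key : ∀ b : PiLp 2 (fun _ : ι => E),
      inner ℝ b (WithLp.toLp 2 (Pi.single p y)) = inner ℝ (b p) y := by
    intro b
    rw [PiLp.inner_apply, Finset.sum_eq_single p (fun q _ hq => by simp [hq]) (by simp)]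
    simp
  simpa only [key] using ha (WithLp.toLp 2 (Pi.single p y))

variable {d : ℕ} {ω : Set (Space d)}

lemma convergesWeakly_of_components {x : ℕ → H2 ω} {v : H2 ω}
    (h : ∀ ι y, Tendsto (fun n => inner ℝ ((x n).1 ι) y) atTop (𝓝 (inner ℝ (v.1 ι) y))) :
    ConvergesWeakly x v := by
  have hc : CompleteSpace (H2 ω) := (isClosed_weakH2 (testFunctions_memLp ω)).completeSpace_coe
  intro f
  obtain ⟨w, rfl⟩ := (InnerProductSpace.toDual ℝ (H2 ω)).surjective f
  have key : ∀ z : H2 ω, InnerProductSpace.toDual ℝ (H2 ω) w z = ∑ ι, inner ℝ (z.1 ι) (w.1 ι) := by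
    intro z
    rw [InnerProductSpace.toDual_apply_apply, real_inner_comm, Submodule.coe_inner,
      PiLp.inner_apply]
  simp only [key]
  exact tendsto_finsetSum _ fun ι _ => h ι _

lemma convergesStronglyH1_of_tendsto {A : Set (Space d)} (hA : A ⊆ ω) {x : ℕ → H2 ω} {v : H2 ω}
    (h : Tendsto (fun n => eLpNorm (x n - v).1.val 2 (volume.restrict A)) atTop (𝓝 0))
    (h' : ∀ i, Tendsto (fun n => eLpNorm ((x n - v).1.grad i) 2 (volume.restrict A)) atTop (𝓝 0)) :
    ConvergesStronglyH1 A x v := by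
  have key : ∀ f g : Lp ℝ 2 (volume.restrict ω),
      eLpNorm (fun x => f x - g x) 2 (volume.restrict A) =
        eLpNorm (f - g : Lp ℝ 2 (volume.restrict ω)) 2 (volume.restrict A) := fun f g =>
    eLpNorm_congr_ae
      (EventuallyEq.symm (ae_mono (Measure.restrict_mono hA le_rfl) (Lp.coeFn_sub f g)))
  refine ⟨?_, fun i => ?_⟩
  · simp only [key]
    exact h
  · simp only [key]
    exact h' i

lemma strong_convergence (hω : IsOpen ω) (hωb : Bornology.IsBounded ω) {x : ℕ → H2 ω} {v : H2 ω}
    {C : ℝ} (hC : ∀ n, ‖x n‖ ≤ C)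
    (h : ∀ ι y, Tendsto (fun n => inner ℝ ((x n).1 ι) y) atTop (𝓝 (inner ℝ (v.1 ι) y))) :
    (∀ K : Set (Space d), IsCompact K → K ⊆ ω → ConvergesStronglyH1 K x v) ∧
      (HasSegmentProperty ω → ConvergesStronglyH1 ω x v) := by
  have : IsFiniteMeasure (volume.restrict ω) := ⟨by simpa using hωb.measure_lt_top⟩
  set B : ℝ := C + ‖v‖ with hB
  have hdiff : ∀ n, ‖x n - v‖ ≤ B := fun n =>
    (norm_sub_le _ _).trans (add_le_add_left (hC n) _)
  have hB0 : 0 ≤ B := (norm_nonneg _).trans (hdiff 0)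
  have hcomp : ∀ n ι, ‖(x n - v).1 ι‖ ≤ B := fun n ι =>
    (PiLp.norm_apply_le (x n - v).1 ι).trans (hdiff n)
  have hsum : ∀ n (κ : Fin d → JetIndex d), ∑ i, ‖(x n - v).1 (κ i)‖ ≤ (d + 1) * B := by
    intro n κ
    refine (Finset.sum_le_card_nsmul _ _ B fun i _ => hcomp n _).trans ?_
    simp only [Finset.card_univ, Fintype.card_fin, nsmul_eq_mul]
    nlinarith
  have hcomp' : ∀ n ι, ‖(x n - v).1 ι‖ ≤ (d + 1) * B := fun n ι =>
    (hcomp n ι).trans (by nlinarith [mul_nonneg (Nat.cast_nonneg (α := ℝ) d) hB0])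
  have hweak : ∀ ι y, Tendsto (fun n => inner ℝ ((x n - v).1 ι) y) atTop (𝓝 0) := by
    intro ι y
    have := (h ι y).sub_const (inner ℝ (v.1 ι) y)
    rw [sub_self] at this
    refine this.congr fun n => ?_
    rw [← inner_sub_left]
    rfl
  have hK : ∀ K : Set (Space d), IsCompact K → K ⊆ ω →
      Tendsto (fun n => eLpNorm (x n - v).1.val 2 (volume.restrict K)) atTop (𝓝 0) :=
    fun K hK hKω => tendsto_eLpNorm_restrict_compact hω (fun n i => (x n - v).2.1 i)
      (fun n => hcomp' n _) (fun n => hsum n _) (hweak _) hK hKω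
  have hK' : ∀ i, ∀ K : Set (Space d), IsCompact K → K ⊆ ω →
      Tendsto (fun n => eLpNorm ((x n - v).1.grad i) 2 (volume.restrict K)) atTop (𝓝 0) :=
    fun i K hK hKω => tendsto_eLpNorm_restrict_compact hω (fun n j => (x n - v).2.2 i j)
      (fun n => hcomp' n _) (fun n => hsum n _) (hweak _) hK hKω
  refine ⟨fun K hKc hKω => convergesStronglyH1_of_tendsto hKω (hK K hKc hKω)
    fun i => hK' i K hKc hKω, fun hseg => convergesStronglyH1_of_tendsto subset_rfl ?_ fun i => ?_⟩
  · exact tendsto_eLpNorm_of_hasSegmentProperty hω hωb hseg (fun n i => (x n - v).2.1 i)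
      (fun n => hsum n _) hK
  · exact tendsto_eLpNorm_of_hasSegmentProperty hω hωb hseg (fun n j => (x n - v).2.2 i j)
      (fun n => hsum n _) (hK' i)

end Limits

section Slices

/-- Square integrable functions on a product as square integrable functions with values in
`L²`. -/
lemma exists_memLp_slices {ι X Y : Type*} [Fintype ι] [MeasurableSpace X] [MeasurableSpace Y]
    {μ : Measure X} {ν : Measure Y} [SFinite μ] [SFinite ν]
    [TopologicalSpace.SeparableSpace (Lp ℝ 2 ν)] {D : ι → X × Y → ℝ}
    (hD : ∀ p, MemLp (D p) 2 (μ.prod ν)) : ∃ M : X → PiLp 2 (fun _ : ι => Lp ℝ 2 ν),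
      MemLp M 2 μ ∧ ∀ᵐ x ∂μ, ∀ p, (M x p : Y → ℝ) =ᵐ[ν] fun y => D p (x, y) := by
  classical
  have hsep : TopologicalSpace.SeparableSpace (PiLp 2 (fun _ : ι => Lp ℝ 2 ν)) :=
    (PiLp.continuousLinearEquiv 2 ℝ (fun _ : ι => Lp ℝ 2 ν)).symm.surjective.denseRange.separableSpace
      (PiLp.continuousLinearEquiv 2 ℝ (fun _ : ι => Lp ℝ 2 ν)).symm.continuous
  let M : X → PiLp 2 (fun _ : ι => Lp ℝ 2 ν) := fun x => WithLp.toLp 2 fun p =>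
    if h : MemLp (fun y => D p (x, y)) 2 ν then h.toLp else 0
  have hmem : ∀ᵐ x ∂μ, ∀ p, MemLp (fun y => D p (x, y)) 2 ν := by
    refine ae_all_iff.2 fun p => ?_
    filter_upwards [(hD p).1.prodMk_left, (hD p).integrable_sq.prod_right_ae] with x h1 h2
    exact (memLp_two_iff_integrable_sq h1).2 h2
  have hM : ∀ᵐ x ∂μ, ∀ p, (M x p : Y → ℝ) =ᵐ[ν] fun y => D p (x, y) := by
    filter_upwards [hmem] with x hx p
    have : M x p = (hx p).toLp := dif_pos (hx p)
    rw [this]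
    exact (hx p).coeFn_toLp
  refine ⟨M, ?_, hM⟩
  have hmeas : AEStronglyMeasurable M μ := by
    refine aestronglyMeasurable_of_inner fun w => ?_
    have h1 : AEStronglyMeasurable (fun x => ∑ p, ∫ y, D p (x, y) * w p y ∂ν) μ := by
      refine Finset.aestronglyMeasurable_fun_sum _ fun p _ => ?_
      exact ((hD p).1.mul (Lp.aestronglyMeasurable (w p)).comp_snd).integral_prod_right'
    refine h1.congr ?_
    filter_upwards [hM] with x hx
    rw [PiLp.inner_apply]
    refine Finset.sum_congr rfl fun p _ => ?_
    rw [real_inner_comm, inner_eq_integral]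
    refine integral_congr_ae ?_
    filter_upwards [hx p] with y hy
    rw [hy]
  rw [memLp_two_iff_integrable_sq_norm hmeas]
  have h2 : Integrable (fun x => ∑ p, ∫ y, D p (x, y) ^ 2 ∂ν) μ :=
    integrable_finsetSum _ fun p _ => (hD p).integrable_sq.integral_prod_left
  refine h2.congr ?_
  filter_upwards [hM] with x hx
  rw [PiLp.norm_sq_eq_of_L2 (fun _ : ι => Lp ℝ 2 ν) (M x)]
  refine Finset.sum_congr rfl fun p _ => ?_
  rw [norm_sq_eq_integral]
  refine integral_congr_ae ?_
  filter_upwards [hx p] with y hy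
  rw [hy]

end Slices

section Corrector

variable {d : ℕ} {ω : Set (Space d)}

/-- A matrix field on `ω × Y` whose slices satisfy the compatibility conditions of periodic second
derivatives, with mean value `w`, is `w` plus a periodic second derivative. -/
lemma exists_corrector [IsFiniteMeasure (volume.restrict ω)]
    {Ξ : Fin d → Fin d → Lp ℝ 2 (cellMeasure ω)} {w : Fin d → Fin d → Lp ℝ 2 (volume.restrict ω)}
    (hsymm : ∀ χ ∈ periodicTestFunctions d, ∀ i j l m, ∀ᵐ x ∂(volume.restrict ω),
      ∫ y in unitCell d, Ξ i j (x, y) * partialDeriv l (partialDeriv m χ) y =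
        ∫ y in unitCell d, Ξ l m (x, y) * partialDeriv i (partialDeriv j χ) y)
    (hmean : ∀ i j, ∀ᵐ x ∂(volume.restrict ω), ∫ y in unitCell d, Ξ i j (x, y) = w i j x) :
    ∃ φ : L2H2per ω, (∀ᵐ x ∂(volume.restrict ω), ∫ y in unitCell d, (φ x).1.val y = 0) ∧
      ∀ i j, RepresentsHess φ i j fun p => Ξ i j p - w i j p.1 := by
  have hD : ∀ q : Fin d × Fin d, MemLp (fun p : Space d × Space d => Ξ q.1 q.2 p - w q.1 q.2 p.1) 2
      ((volume.restrict ω).prod (cellVol d)) := fun q =>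
    (Lp.memLp (Ξ q.1 q.2)).sub ((Lp.memLp (w q.1 q.2)).comp_measurePreserving
      (measurePreserving_fst (μ := volume.restrict ω) (ν := cellVol d)))
  obtain ⟨M, hM, hMD⟩ := exists_memLp_slices hD
  obtain ⟨P, hP, hPhess⟩ := exists_hessian_inverse d
  have hPM : MemLp (fun x => P (M x)) 2 (volume.restrict ω) := P.comp_memLp' hM
  refine ⟨hPM.toLp, ?_, fun i j => ⟨(hD (i, j)).1, ?_⟩⟩
  · filter_upwards [hPM.coeFn_toLp] with x hx
    rw [hx]
    exact hP (M x)
  have hslice : ∀ᵐ x ∂(volume.restrict ω), ∀ q : Fin d × Fin d,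
      MemLp (fun y => Ξ q.1 q.2 (x, y)) 2 (cellVol d) := by
    refine ae_all_iff.2 fun q => ?_
    have h := Lp.memLp (Ξ q.1 q.2)
    filter_upwards [h.1.prodMk_left, h.integrable_sq.prod_right_ae] with x h1 h2
    exact (memLp_two_iff_integrable_sq h1).2 h2
  have hsymm' : ∀ᵐ x ∂(volume.restrict ω), ∀ (k : Fin d → ℤ) b i j l m,
      ∫ y in unitCell d, Ξ i j (x, y) * partialDeriv l (partialDeriv m (trig k b)) y =
        ∫ y in unitCell d, Ξ l m (x, y) * partialDeriv i (partialDeriv j (trig k b)) y := by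
    simp only [ae_all_iff]
    exact fun k b => hsymm _ (trig_mem_periodicTestFunctions k b)
  have hmean' : ∀ᵐ x ∂(volume.restrict ω), ∀ i j, ∫ y in unitCell d, Ξ i j (x, y) = w i j x := by
    simp only [ae_all_iff]
    exact hmean
  filter_upwards [hPM.coeFn_toLp, hMD, hslice, hsymm', hmean'] with x hx hxM hxs hxsymm hxmean
  have hint : ∀ (q : Fin d × Fin d) {χ : Space d → ℝ}, χ ∈ periodicTestFunctions d →
      ∫ y, M x q y * χ y ∂(cellVol d) = ∫ y, Ξ q.1 q.2 (x, y) * χ y ∂(cellVol d) -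
        w q.1 q.2 x * ∫ y, χ y ∂(cellVol d) := by
    intro q χ hχ
    have hm := (periodicTestFunctions_memLp d χ hχ).1
    rw [← integral_const_mul, ← integral_sub (integrable_mul_of_memLp (hxs q) hm)
      ((hm.integrable (by norm_num)).const_mul _)]
    refine integral_congr_ae ?_
    filter_upwards [hxM q] with y hy
    rw [hy, sub_mul]
  have hzero : ∀ q, ∫ y, M x q y ∂(cellVol d) = 0 := by
    intro q
    have := hint q (const_mem_periodicTestFunctions 1)
    simp only [mul_one] at this
    rw [this, hxmean]
    simp
  have hper : ∀ (k : Fin d → ℤ) b l m,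
      partialDeriv l (partialDeriv m (trig k b)) ∈ periodicTestFunctions d ∧
        ∫ y, partialDeriv l (partialDeriv m (trig k b)) y ∂(cellVol d) = 0 := fun k b l m =>
    have h := partialDeriv_mem_periodicTestFunctions (trig_mem_periodicTestFunctions k b) m
    ⟨partialDeriv_mem_periodicTestFunctions h l, integral_partialDeriv_unitCell h l⟩
  have := hPhess (M x) hzero (fun k b i j l m => by
    rw [hint _ (hper k b l m).1, hint _ (hper k b i j).1, (hper k b l m).2, (hper k b i j).2,
      mul_zero, mul_zero, sub_zero, sub_zero]
    exact hxsymm k b i j l m) i j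
  rw [hx, this]
  exact (hxM (i, j)).symm

end Corrector

end TwoScale

end

open TwoScale in
theorem theorem3p3 (d : ℕ) (ω : Set (Space d)) (hω_open : IsOpen ω) (hω_conn : IsConnected ω)
    (hω_bdd : Bornology.IsBounded ω)
    (ε : ℕ → ℝ) (hε_pos : ∀ n, 0 < ε n) (hε : Tendsto ε atTop (𝓝 0))
    (u : ℕ → H2 ω) (hu : ∃ C : ℝ, ∀ n, ‖u n‖ ≤ C) :
    ∃ σ : ℕ → ℕ, StrictMono σ ∧ ∃ v : H2 ω,
      ConvergesWeakly (fun n => u (σ n)) v ∧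
      (∀ K : Set (Space d), IsCompact K → K ⊆ ω →
        ConvergesStronglyH1 K (fun n => u (σ n)) v) ∧
      (HasSegmentProperty ω → ConvergesStronglyH1 ω (fun n => u (σ n)) v) ∧
      ∃ φ : L2H2per ω,
        (∀ᵐ x ∂(volume.restrict ω), ∫ y in unitCell d, (φ x).1.val y = 0) ∧
        ∃ D : Fin d → Fin d → Space d × Space d → ℝ,
          (∀ i j, RepresentsHess φ i j (D i j)) ∧
          ∀ i j, ConvergesWeaklyTwoScale ω (fun n => ε (σ n))
            (fun n => (u (σ n)).1.hess i j)
            (fun p => v.1.hess i j p.1 + D i j p) := by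
  obtain ⟨C, hC⟩ := hu
  have : IsFiniteMeasure (volume.restrict ω) := ⟨by simpa using hω_bdd.measure_lt_top⟩
  have hhess : ∀ n i j, ‖(u n).1.hess i j‖ ≤ C := fun n i j =>
    (PiLp.norm_apply_le (u n).1 _).trans (hC n)
  obtain ⟨σ₁, hσ₁, J, hJ⟩ := exists_componentwise_weak_limit (fun n => (u n).1) C hC
  let U : ℕ → PiLp 2 (fun _ : Fin d × Fin d => Lp ℝ 2 (cellMeasure ω)) := fun n =>
    WithLp.toLp 2 fun p => (memLp_unfolding (hε_pos n) ((u n).1.hess p.1 p.2)).toLp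
  have hU : ∀ n, ‖U n‖ ≤ C := by
    intro n
    have hC0 : 0 ≤ C := (norm_nonneg _).trans (hC n)
    refine (sq_le_sq₀ (norm_nonneg _) hC0).1 (le_trans ?_ (pow_le_pow_left₀ (norm_nonneg _) (hC n) 2))
    have hn : ‖u n‖ ^ 2 = _ := Jet.norm_sq (u n).1
    rw [hn, PiLp.norm_sq_eq_of_L2 (fun _ : Fin d × Fin d => Lp ℝ 2 (cellMeasure ω)) (U n),
      Fintype.sum_prod_type]
    refine le_add_of_nonneg_of_le (sq_nonneg _) (le_add_of_nonneg_of_le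
      (Finset.sum_nonneg fun i _ => sq_nonneg _) (Finset.sum_le_sum fun i _ =>
        Finset.sum_le_sum fun j _ => ?_))
    exact pow_le_pow_left₀ (norm_nonneg _) (norm_toLp_unfolding_le (hε_pos n) _) 2
  obtain ⟨σ₂, hσ₂, Ξ, hΞ⟩ := exists_componentwise_weak_limit (fun n => U (σ₁ n)) C
    fun n => hU _
  let v : H2 ω := ⟨J, weakH2_mem_of_tendsto _ (fun n => (u (σ₁ n)).2) hJ⟩
  have hσ : StrictMono (σ₁ ∘ σ₂) := hσ₁.comp hσ₂
  have hv : ∀ ι y, Tendsto (fun n => inner ℝ ((u (σ₁ (σ₂ n))).1 ι) y) atTop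
      (𝓝 (inner ℝ (v.1 ι) y)) := fun ι y => (hJ ι y).comp hσ₂.tendsto_atTop
  have hε' : Tendsto (fun n => ε (σ₁ (σ₂ n))) atTop (𝓝 0) := hε.comp hσ.tendsto_atTop
  have hΞ' : ∀ i j y, Tendsto (fun n => inner ℝ (memLp_unfolding (hε_pos (σ₁ (σ₂ n)))
      ((u (σ₁ (σ₂ n))).1.hess i j)).toLp y) atTop (𝓝 (inner ℝ (Ξ (i, j)) y)) :=
    fun i j y => hΞ (i, j) y
  obtain ⟨hK, hseg⟩ := strong_convergence hω_open hω_bdd (fun n => hC (σ₁ (σ₂ n))) hv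
  obtain ⟨φ, hφ, hφD⟩ := exists_corrector (Ξ := fun i j => Ξ (i, j))
    (w := fun i j => v.1.hess i j)
    (fun χ hχ => ae_integral_twoScale_symm hω_open (fun n => hε_pos (σ₁ (σ₂ n))) hε'
      (u := fun n => u (σ₁ (σ₂ n))) (fun n => hhess _) hΞ' hχ)
    (fun i j => ae_integral_twoScale_eq hω_open (fun n => hε_pos (σ₁ (σ₂ n))) hε'
      (fun n => hhess (σ₁ (σ₂ n)) i j) (hΞ' i j) (hv _))
  refine ⟨σ₁ ∘ σ₂, hσ, v, convergesWeakly_of_components hv, hK, hseg, φ, hφ, _, hφD,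
    fun i j => ⟨⟨C, fun n => hhess _ i j⟩, fun n => memLp_unfolding (hε_pos _) _, ?_⟩⟩
  simp only [add_sub_cancel]
  refine ⟨Lp.memLp _, fun ψ hψ => ?_⟩
  have := hΞ' i j hψ.toLp
  rw [inner_toLp] at this
  refine this.congr fun n => ?_
  rw [inner_toLp]
  refine integral_congr_ae ?_
  filter_upwards [(memLp_unfolding (hε_pos (σ₁ (σ₂ n))) ((u (σ₁ (σ₂ n))).1.hess i j)).coeFn_toLp]
    with p hp
  rw [hp]
  rfl
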